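/- Write permutations $\sigma\in S_n$ in vector notation $\sigma=[\sigma(1),\dots,\sigma(n)]$. For $1<j\le n$ the push-to-the-top transition $t_{\uparrow j}:S_n\to S_n$ moves the $j$-th entry to the first place: $$t_{\uparrow j}([a_1,\dots,a_n])=[a_j,a_1,\dots,a_{j-1},a_{j+1},\dots,a_n].$$ The Kendall $\tau$-distance $d_{\mathcal K}(\sigma,\tau)$ is the minimal number of adjacent transpositions required to transform one vector into the other, that is, the minimal $r$ such that $\sigma=\tau\circ(i_1,i_1+1)\circ\cdots\circ(i_r,i_r+1)$ for some $i_1,\dots,i_r\in\{1,\dots,n-1\}$. An $(n,M,\mathcal K)$-snake is a sequence $c_1,\dots,c_M$ of $M$ distinct elements of $S_n$ such that, cyclically, each $c_{r+1}$ (with $c_{M+1}=c_1$) equals $t_{\uparrow j}(c_r)$ for some $1<j\le n$, and such that $d_{\mathcal K}(c_r,c_s)\ge 2$ for all $r\ne s$ (so that a single error is detected). **Theorem.** For every $m\ge 2$ there exists a $(2m+2,\check M_{2m+2},\mathcal K)$-snake, where $$\check M_{2m+2}=\frac{2m}{2m+2}\cdot\frac{(2m+2)!}{2}-(2m-2)\,2m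 .$$ In particular $\check M_{2m+2}/|S_{2m+2}|\to\frac12$ as $m\to\infty$, and this is asymptotically optimal: for all $n$ and $M$, every $(n,M,\mathcal K)$-snake satisfies $M/|S_n|\le\frac12$. -/

import Mathlib

open Filter Topology

namespace RankModulation

/-- The push-to-the-top transition `t_{↑j}` on permutations in vector notation,
`[a₁, …, a_{j-1}, a_j, a_{j+1}, …, a_n] ↦ [a_j, a₁, …, a_{j-1}, a_{j+1}, …, a_n]`, i.e.
`σ ↦ σ ∘ (j, j-1, …, 1)`. The set `[n]` is modelled by `Fin n`, so the top index is `0`;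
`j.cycleRange` is the cycle `0 ↦ 1 ↦ ⋯ ↦ j ↦ 0`. -/
def pushToTop {n : ℕ} (j : Fin n) (σ : Equiv.Perm (Fin n)) : Equiv.Perm (Fin n) :=
  σ * (Fin.cycleRange j)⁻¹

/-- The entry at index `j` is moved to the top. -/
theorem pushToTop_zero {n : ℕ} (j : Fin (n + 1)) (σ : Equiv.Perm (Fin (n + 1))) :
    pushToTop j σ 0 = σ j := by
  have h : (Fin.cycleRange j)⁻¹ 0 = j := by
    rw [Equiv.Perm.inv_eq_iff_eq, Fin.cycleRange_self]
  simp [pushToTop, Equiv.Perm.mul_apply, h]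

/-- The entries above index `j` are moved down by one place. -/
theorem pushToTop_of_lt {n : ℕ} (j k l : Fin (n + 1)) (σ : Equiv.Perm (Fin (n + 1)))
    (hkj : k < j) (hl : (l : ℕ) = k + 1) : pushToTop j σ l = σ k := by
  have h : (Fin.cycleRange j)⁻¹ l = k := by
    rw [Equiv.Perm.inv_eq_iff_eq]
    apply Fin.ext
    rw [Fin.coe_cycleRange_of_lt hkj, hl]
  simp [pushToTop, Equiv.Perm.mul_apply, h]

/-- The entries below index `j` stay in place. -/
theorem pushToTop_of_gt {n : ℕ} (j k : Fin (n + 1)) (σ : Equiv.Perm (Fin (n + 1)))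
    (hjk : j < k) : pushToTop j σ k = σ k := by
  have h : (Fin.cycleRange j)⁻¹ k = k := by
    rw [Equiv.Perm.inv_eq_iff_eq, Fin.cycleRange_of_gt hjk]
  simp [pushToTop, Equiv.Perm.mul_apply, h]

/-- `c = (c₁, …, c_M)` is a `G_↑(n, M)` code: a cyclic Gray code over `S_n`, of size `M`, whose
transitions are the push-to-the-top transitions `t_{↑j}` with `1 < j ≤ n`. Here `finRotate M r`
is the cyclic successor of the index `r`. -/
def IsPushToTopGrayCode (n M : ℕ) (c : Fin M → Equiv.Perm (Fin n)) : Prop :=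
  Function.Injective c ∧
    ∀ r : Fin M, ∃ j : Fin n, 0 < (j : ℕ) ∧ c (finRotate M r) = pushToTop j (c r)

/-- `s` is an adjacent transposition `(i, i+1)`. -/
def IsAdjTransposition {n : ℕ} (s : Equiv.Perm (Fin n)) : Prop :=
  ∃ i j : Fin n, (i : ℕ) + 1 = j ∧ s = Equiv.swap i j

/-- The Kendall τ-distance: the minimal `r` such that
`σ = τ ∘ (i₁, i₁+1) ∘ (i₂, i₂+1) ∘ ⋯ ∘ (i_r, i_r+1)` for some `i₁, …, i_r`. -/
noncomputable def kendallTau {n : ℕ} (σ τ : Equiv.Perm (Fin n)) : ℕ :=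
  sInf {r : ℕ | ∃ l : List (Equiv.Perm (Fin n)),
    l.length = r ∧ (∀ s ∈ l, IsAdjTransposition s) ∧ σ = τ * l.prod}

/-- The minimum defining the Kendall τ-distance is attained. -/
theorem kendallTau_spec {n : ℕ} (σ τ : Equiv.Perm (Fin n)) :
    ∃ l : List (Equiv.Perm (Fin n)), l.length = kendallTau σ τ ∧
      (∀ s ∈ l, IsAdjTransposition s) ∧ σ = τ * l.prod := by
  refine Nat.sInf_mem (s := {r : ℕ | ∃ l : List (Equiv.Perm (Fin n)),
    l.length = r ∧ (∀ s ∈ l, IsAdjTransposition s) ∧ σ = τ * l.prod}) ?_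
  have key : ∃ l : List (Equiv.Perm (Fin n)),
      (∀ s ∈ l, IsAdjTransposition s) ∧ l.prod = τ⁻¹ * σ := by
    cases n with
    | zero => exact ⟨[], by simp, Subsingleton.elim _ _⟩
    | succ n =>
      have h : τ⁻¹ * σ ∈ Submonoid.closure
          (Set.range fun i : Fin n => Equiv.swap i.castSucc i.succ) := by
        rw [Equiv.Perm.mclosure_swap_castSucc_succ]; trivial
      obtain ⟨l, hl, hp⟩ := Submonoid.exists_list_of_mem_closure h
      refine ⟨l, fun s hs => ?_, hp⟩
      obtain ⟨i, rfl⟩ := hl s hs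
      exact ⟨i.castSucc, i.succ, by simp, rfl⟩
  obtain ⟨l, hl, hp⟩ := key
  exact ⟨l.length, l, rfl, hl, by rw [hp]; group⟩

/-- `c` is an `(n, M, 𝒦)`-snake: a `G_↑(n, M)` code that detects a single Kendall τ-error, i.e.
any two distinct codewords are at Kendall τ-distance at least `2`. -/
def IsKendallSnake (n M : ℕ) (c : Fin M → Equiv.Perm (Fin n)) : Prop :=
  IsPushToTopGrayCode n M c ∧
    ∀ σ ∈ Set.range c, ∀ τ ∈ Set.range c, σ ≠ τ → 2 ≤ kendallTau σ τ

end RankModulation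

/-!
Two permutations of equal sign are never one adjacent transposition apart, so the snake can consist
mainly of even permutations. The even permutations fixing the last of `n = l + 4` indices, `l` even,
form a copy of `A_{l+3}`. In it, let `a` and `b` be the pushes from index `l` and from the last
index. A coset of `⟨a⟩` is a cycle of pushes, and it is determined by the cyclic arrangement of the
first `l + 1` entries. As `(a b⁻¹) ^ 3 = 1`, replacing three steps `a` by steps `b` joins three such
cycles into one, whenever their arrangements differ from each other in one place. Joining along a
hypertree of these triples, which spans all cyclic arrangements but one, gives a path through
`A_{l+3}` that misses one coset of `⟨a⟩` only.

A push from the last index in `S_n` at the end of the path leads to an odd permutation, and a second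
one to a translate of the starting point, by `ρ` say. The path and its translates by the powers of
`ρ` are thereby linked to a cycle. An odd permutation on it can be one adjacent transposition away
from even ones of the same or of the next translate; the missed coset is chosen to contain these.

Conversely, a code that detects one error has at most one element of each pair `{σ, σ ∘ (1, 2)}`.
-/

namespace RankModulation

section Hamiltonian

variable {V W : Type*} {R : V → V → Prop} {S T : Set V} {x y : V}

/-- A Hamiltonian path from `x` to `y` in the directed graph that `R` induces on `S`, given as the
list of its vertices. -/
def HasHamiltonianPath (R : V → V → Prop) (S : Set V) (x y : V) : Prop :=
  ∃ L : List V, L.Nodup ∧ (∀ z, z ∈ L ↔ z ∈ S) ∧ L.IsChain R ∧ L.head? = some x ∧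
    L.getLast? = some y

/-- A Hamiltonian cycle in the directed graph that `R` induces on `S`; a loop is allowed if `S` is a
single vertex. -/
def HasHamiltonianCycle (R : V → V → Prop) (S : Set V) : Prop :=
  ∃ s : Cycle V, s.Nodup ∧ (∀ z, z ∈ s ↔ z ∈ S) ∧ s.Chain R

theorem HasHamiltonianPath.singleton (x : V) : HasHamiltonianPath R {x} x x :=
  ⟨[x], by simp⟩

theorem HasHamiltonianPath.append {x' y' : V} (hS : HasHamiltonianPath R S x y)
    (hT : HasHamiltonianPath R T x' y') (hST : Disjoint S T) (h : R y x') :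
    HasHamiltonianPath R (S ∪ T) x y' := by
  obtain ⟨L, hL, hLS, hLR, hLx, hLy⟩ := hS
  obtain ⟨K, hK, hKT, hKR, hKx, hKy⟩ := hT
  refine ⟨L ++ K, hL.append hK fun z hzL hzK => ?_, fun z => ?_, ?_, ?_, ?_⟩
  · exact Set.disjoint_left.1 hST ((hLS z).1 hzL) ((hKT z).1 hzK)
  · rw [List.mem_append, hLS, hKT, Set.mem_union]
  · refine List.isChain_append.2 ⟨hLR, hKR, fun a ha b hb => ?_⟩
    rw [hLy, Option.mem_some_iff] at ha
    rw [hKx, Option.mem_some_iff] at hb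
    rwa [← ha, ← hb]
  · rw [List.head?_append, hLx, Option.some_or]
  · rw [List.getLast?_append, hKy, Option.some_or]

theorem HasHamiltonianPath.image {R' : W → W → Prop} {f : V → W} (hf : Function.Injective f)
    (hR : ∀ u v, R u v → R' (f u) (f v)) (h : HasHamiltonianPath R S x y) :
    HasHamiltonianPath R' (f '' S) (f x) (f y) := by
  obtain ⟨L, hL, hLS, hLR, hLx, hLy⟩ := h
  refine ⟨L.map f, hL.map hf, fun z => ?_, ?_, ?_, ?_⟩
  · simp only [List.mem_map, hLS, Set.mem_image]
  · exact (List.isChain_map f).2 (hLR.imp hR)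
  · rw [List.head?_map, hLx, Option.map_some]
  · rw [List.getLast?_map, hLy, Option.map_some]

theorem HasHamiltonianPath.mono {R' : V → V → Prop} (hR : ∀ u v, R u v → R' u v)
    (h : HasHamiltonianPath R S x y) : HasHamiltonianPath R' S x y := by
  simpa using h.image (f := id) Function.injective_id hR

theorem HasHamiltonianPath.hasHamiltonianCycle (h : HasHamiltonianPath R S x y) (hyx : R y x) :
    HasHamiltonianCycle R S := by
  obtain ⟨L, hL, hLS, hLR, hLx, hLy⟩ := h
  obtain ⟨K, rfl⟩ := List.head?_eq_some_iff.1 hLx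
  refine ⟨(x :: K : List V), Cycle.nodup_coe_iff.2 hL, by simpa using hLS, ?_⟩
  rw [Cycle.chain_coe_cons, ← List.cons_append]
  refine List.isChain_append.2 ⟨hLR, List.isChain_singleton x, fun a ha b hb => ?_⟩
  rw [hLy, Option.mem_some_iff] at ha
  rw [List.head?_cons, Option.mem_some_iff] at hb
  rwa [← ha, ← hb]

theorem HasHamiltonianCycle.exists_path (h : HasHamiltonianCycle R S) (hx : x ∈ S) :
    ∃ y ∈ S, R x y ∧ HasHamiltonianPath R S y x := by
  obtain ⟨s, hs, hsS, hsR⟩ := h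
  induction s using Quotient.inductionOn with
  | _ L =>
  change (L : Cycle V).Nodup at hs
  change ∀ z, z ∈ (L : Cycle V) ↔ z ∈ S at hsS
  change (L : Cycle V).Chain R at hsR
  obtain ⟨K, K', rfl⟩ := List.append_of_mem (Cycle.mem_coe_iff.1 ((hsS x).2 hx))
  have hrot : ((K ++ x :: K' : List V) : Cycle V) = (x :: (K' ++ K) : List V) :=
    Cycle.coe_eq_coe.2 (by simpa using List.isRotated_append (l := K) (l' := x :: K'))
  rw [hrot] at hs hsS hsR
  rw [Cycle.chain_coe_cons] at hsR
  obtain ⟨y, L', hL'⟩ : ∃ y L', K' ++ K ++ [x] = y :: L' := List.exists_cons_of_ne_nil (by simp)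
  have hmem : ∀ z, z ∈ K' ++ K ++ [x] ↔ z ∈ S := fun z => by
    rw [(List.perm_append_singleton x _).mem_iff, ← Cycle.mem_coe_iff, hsS]
  rw [hL', List.isChain_cons_cons] at hsR
  refine ⟨y, (hmem y).1 (by simp [hL']), hsR.1, K' ++ K ++ [x], ?_, hmem, hL' ▸ hsR.2, ?_, ?_⟩
  · exact (List.perm_append_singleton x _).nodup_iff.2 (Cycle.nodup_coe_iff.1 hs)
  · rw [hL', List.head?_cons]
  · exact List.getLast?_concat

theorem HasHamiltonianCycle.mono {R' : V → V → Prop} (hR : ∀ u v, R u v → R' u v)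
    (h : HasHamiltonianCycle R S) : HasHamiltonianCycle R' S :=
  let ⟨s, hs, hsS, hsR⟩ := h
  ⟨s, hs, hsS, hsR.imp hR⟩

end Hamiltonian

section HyperTree

variable {V W : Type*} {E : V → V → V → Prop}

/-- The vertex sets of hypertrees in the `3`-uniform hypergraph with edges `E`: a single vertex is a
hypertree, and three disjoint hypertrees can be joined along an edge. -/
inductive IsHyperTree (E : V → V → V → Prop) : Set V → Prop
  | singleton (v : V) : IsHyperTree E {v}
  | join {S T U : Set V} {p q r : V} : IsHyperTree E S → IsHyperTree E T → IsHyperTree E U →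
      Disjoint S T → Disjoint S U → Disjoint T U → p ∈ S → q ∈ T → r ∈ U → E p q r →
      IsHyperTree E (S ∪ (T ∪ U))

theorem IsHyperTree.image {E' : W → W → W → Prop} {f : V → W} {S : Set V} (hS : IsHyperTree E S)
    (hf : S.InjOn f) (hE : ∀ p q r, E p q r → E' (f p) (f q) (f r)) :
    IsHyperTree E' (f '' S) := by
  induction hS with
  | singleton v => simpa only [Set.image_singleton] using .singleton (f v)
  | @join S T U p q r _ _ _ hST hSU hTU hp hq hr hpqr ihS ihT ihU =>
    have hTU' : T ∪ U ⊆ S ∪ (T ∪ U) := Set.subset_union_right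
    have hS' : S ⊆ S ∪ (T ∪ U) := Set.subset_union_left
    have hT' : T ⊆ S ∪ (T ∪ U) := Set.subset_union_left.trans hTU'
    have hU' : U ⊆ S ∪ (T ∪ U) := Set.subset_union_right.trans hTU'
    rw [Set.image_union, Set.image_union]
    exact .join (ihS (hf.mono hS')) (ihT (hf.mono hT')) (ihU (hf.mono hU'))
      (Set.disjoint_image_image fun _ hu _ hv h =>
        hST.ne_of_mem hu hv (hf (hS' hu) (hT' hv) h))
      (Set.disjoint_image_image fun _ hu _ hv h =>
        hSU.ne_of_mem hu hv (hf (hS' hu) (hU' hv) h))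
      (Set.disjoint_image_image fun _ hu _ hv h =>
        hTU.ne_of_mem hu hv (hf (hT' hu) (hU' hv) h))
      (Set.mem_image_of_mem f hp) (Set.mem_image_of_mem f hq) (Set.mem_image_of_mem f hr)
      (hE p q r hpqr)

theorem IsHyperTree.union_pair {S : Set V} {p q r : V} (hS : IsHyperTree E S) (hp : p ∈ S)
    (hq : q ∉ S) (hr : r ∉ S) (hqr : q ≠ r) (h : E p q r) : IsHyperTree E (S ∪ {q, r}) := by
  rw [Set.insert_eq]
  exact hS.join (.singleton q) (.singleton r) (Set.disjoint_singleton_right.2 hq)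
    (Set.disjoint_singleton_right.2 hr) (Set.disjoint_singleton.2 hqr) hp rfl rfl h

theorem IsHyperTree.union_biUnion {I : Type*} {S : Set V} (hS : IsHyperTree E S) {J : Set I}
    (hJ : J.Finite) {Q R : I → Set V} (hQ : ∀ i ∈ J, IsHyperTree E (Q i))
    (hR : ∀ i ∈ J, IsHyperTree E (R i)) (hQR : ∀ i ∈ J, Disjoint (Q i) (R i))
    (hSQR : ∀ i ∈ J, Disjoint S (Q i ∪ R i)) (hJQR : J.PairwiseDisjoint fun i => Q i ∪ R i)
    (hE : ∀ i ∈ J, ∃ p ∈ S, ∃ q ∈ Q i, ∃ r ∈ R i, E p q r) :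
    IsHyperTree E (S ∪ ⋃ i ∈ J, (Q i ∪ R i)) := by
  induction J, hJ using Set.Finite.induction_on with
  | empty => simpa using hS
  | @insert j J hj _ ih =>
    simp only [Set.forall_mem_insert] at hQ hR hQR hSQR hE
    rw [Set.pairwiseDisjoint_insert_of_notMem hj] at hJQR
    obtain ⟨p, hp, q, hq, r, hr, hpqr⟩ := hE.1
    have hdisj : Disjoint (S ∪ ⋃ i ∈ J, (Q i ∪ R i)) (Q j ∪ R j) := by
      rw [Set.disjoint_union_left, Set.disjoint_iUnion₂_left]
      exact ⟨hSQR.1, fun i hi => (hJQR.2 i hi).symm⟩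
    rw [Set.biUnion_insert, Set.union_comm (Q j ∪ R j), ← Set.union_assoc]
    rw [Set.disjoint_union_right] at hdisj
    exact (ih hQ.2 hR.2 hQR.2 hSQR.2 hJQR.1 hE.2).join hQ.1 hR.1 hdisj.1 hdisj.2 hQR.1 (.inl hp)
      hq hr hpqr

end HyperTree

section Arrangements

variable {α : Type*}

/-- The arrangements of `l` distinct elements of `F`, as lists. -/
def arrangements (F : Finset α) (l : ℕ) : Set (List α) :=
  {s | s.Nodup ∧ s.length = l ∧ ∀ x ∈ s, x ∈ F}

/-- The hyperedges on arrangements: three lists that agree except for three different entries in one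
place. -/
def DifferInOnePlace (p q r : List α) : Prop :=
  ∃ (u v : List α) (x y z : α), x ≠ y ∧ x ≠ z ∧ y ≠ z ∧
    p = u ++ x :: v ∧ q = u ++ y :: v ∧ r = u ++ z :: v

theorem DifferInOnePlace.head {x y z : α} (hxy : x ≠ y) (hxz : x ≠ z) (hyz : y ≠ z)
    (s : List α) : DifferInOnePlace (x :: s) (y :: s) (z :: s) :=
  ⟨[], s, x, y, z, hxy, hxz, hyz, rfl, rfl, rfl⟩

theorem DifferInOnePlace.cons {p q r : List α} (h : DifferInOnePlace p q r) (e : α) :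
    DifferInOnePlace (e :: p) (e :: q) (e :: r) := by
  obtain ⟨u, v, x, y, z, hxy, hxz, hyz, rfl, rfl, rfl⟩ := h
  exact ⟨e :: u, v, x, y, z, hxy, hxz, hyz, rfl, rfl, rfl⟩

theorem finite_arrangements (F : Finset α) (l : ℕ) : (arrangements F l).Finite := by
  refine ((List.finite_length_eq F l).image (List.map Subtype.val)).subset ?_
  rintro s ⟨-, hl, hs⟩
  lift s to List F using hs
  exact ⟨s, by simpa using hl, rfl⟩

theorem cons_mem_arrangements [DecidableEq α] {F : Finset α} {l : ℕ} {x : α} {s : List α} :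
    x :: s ∈ arrangements F (l + 1) ↔ x ∈ F ∧ s ∈ arrangements (F.erase x) l := by
  simp only [arrangements, Set.mem_ofPred_eq, List.nodup_cons, List.length_cons,
    add_left_inj, List.forall_mem_cons, Finset.mem_erase]
  grind

theorem arrangements_mono {F G : Finset α} (h : F ⊆ G) (l : ℕ) :
    arrangements F l ⊆ arrangements G l :=
  fun _ hs => ⟨hs.1, hs.2.1, fun x hx => h (hs.2.2 x hx)⟩

theorem mem_of_mem_arrangements {F : Finset α} {s : List α} (hs : s ∈ arrangements F F.card)
    {x : α} (hx : x ∈ F) : x ∈ s := by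
  classical
  have h : s.toFinset = F := Finset.eq_of_subset_of_card_le
    (fun y hy => hs.2.2 y (List.mem_toFinset.1 hy))
    (by rw [List.toFinset_card_of_nodup hs.1, hs.2.1])
  rwa [← List.mem_toFinset, h]

theorem exists_mem_arrangements_ne {F : Finset α} (hF : 2 ≤ F.card) (t : List α) :
    ∃ s ∈ arrangements F F.card, s ≠ t := by
  have hmem (k : ℕ) : F.toList.rotate k ∈ arrangements F F.card :=
    ⟨List.nodup_rotate.2 F.nodup_toList, by simp, by simp⟩
  have hne : F.toList.rotate 0 ≠ F.toList.rotate 1 := by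
    rw [Ne, F.nodup_toList.rotate_congr_iff, Finset.length_toList]
    rintro (h | h)
    · rw [Nat.zero_mod, Nat.mod_eq_of_lt (by lia)] at h
      exact zero_ne_one h
    · simp [Finset.toList_eq_nil.1 h] at hF
  by_contra! h
  exact hne ((h _ (hmem 0)).trans (h _ (hmem 1)).symm)

theorem isHyperTree_arrangements_two [DecidableEq α] {a b c d : α} (h : [a, b, c, d].Nodup) :
    IsHyperTree DifferInOnePlace (arrangements {a, b, c, d} 2 \ {[c, d]}) := by
  have hT : arrangements {a, b, c, d} 2 \ {[c, d]} =
      {[a, b]} ∪ {[a, c], [a, d]} ∪ {[c, b], [d, b]} ∪ {[b, c], [d, c]} ∪ {[b, a], [b, d]} ∪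
        {[c, a], [d, a]} := by
    ext s
    simp only [arrangements, Set.mem_sdiff, Set.mem_ofPred_eq, Set.mem_union, Set.mem_insert_iff,
      Set.mem_singleton_iff, Finset.mem_insert, Finset.mem_singleton]
    constructor
    · rintro ⟨⟨hs, hlen, hmem⟩, hcd⟩
      obtain ⟨x, y, rfl⟩ := List.length_eq_two.1 hlen
      simp only [List.forall_mem_cons] at hmem
      grind
    · rintro (((((rfl | rfl | rfl) | rfl | rfl) | rfl | rfl) | rfl | rfl) | rfl | rfl) <;> grind
  simp only [List.nodup_cons, List.mem_cons, List.not_mem_nil, or_false, not_or] at h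
  obtain ⟨⟨hab, hac, had⟩, ⟨hbc, hbd⟩, hcd, -⟩ := h
  rw [hT]
  have row (e : α) {x y z : α} (hxy : x ≠ y) (hxz : x ≠ z) (hyz : y ≠ z) :
      DifferInOnePlace [e, x] [e, y] [e, z] := (DifferInOnePlace.head hxy hxz hyz []).cons e
  refine .union_pair (p := [b, a]) (.union_pair (p := [b, c]) (.union_pair (p := [a, c])
    (.union_pair (p := [a, b]) (.union_pair (p := [a, b]) (.singleton _) rfl ?_ ?_ ?_
      (row a hbc hbd hcd)) ?_ ?_ ?_ ?_ (.head hac had hcd [b]))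
      ?_ ?_ ?_ ?_ (.head hab had hbd [c])) ?_ ?_ ?_ ?_ (row b (Ne.symm hac) hcd had))
      ?_ ?_ ?_ ?_ (.head hbc hbd hcd [a])
  all_goals grind

theorem exists_perm_bijOn_no_short_cycles {F : Finset α} (hF : 3 ≤ F.card) :
    ∃ σ : Equiv.Perm α, Set.BijOn σ F F ∧ ∀ x ∈ F, σ x ≠ x ∧ σ (σ x) ≠ x := by
  obtain ⟨σ, hσ, -⟩ := F.countable_toSet.exists_cycleOn
  refine ⟨σ, hσ.1, fun x hx => ⟨fun h => ?_, fun h => ?_⟩⟩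
  · have := Nat.le_of_dvd one_pos ((hσ.pow_apply_eq hx).1 (by simpa using h : (σ ^ 1) x = x))
    lia
  · have := Nat.le_of_dvd two_pos
      ((hσ.pow_apply_eq hx).1 (by simpa [pow_two] using h : (σ ^ 2) x = x))
    lia

/-- The one arrangement `σ x :: u (σ x)` left out among those that start with `σ x` is listed with
the arrangements that start with `x`, so that an edge can attach both at once to those that start
with `e`. -/
theorem arrangements_sdiff_eq_union [DecidableEq α] {F : Finset α} {l : ℕ} {e : α} (he : e ∈ F)
    (s₁ : List α) {σ : Equiv.Perm α} (hσ : Set.BijOn σ (F.erase e) (F.erase e)) {u : α → List α}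
    (hu : ∀ x ∈ F.erase e, u x ∈ arrangements (F.erase x) l) :
    arrangements F (l + 1) \ {e :: s₁} =
      List.cons e '' (arrangements (F.erase e) l \ {s₁}) ∪ ⋃ x ∈ (F.erase e : Set α),
        (List.cons x '' (arrangements (F.erase x) l \ {u x}) ∪ {σ x :: u (σ x)}) := by
  ext s
  rcases s with _ | ⟨x, s⟩
  · simp [arrangements]
  simp only [Set.mem_sdiff, cons_mem_arrangements, Set.mem_singleton_iff, List.cons.injEq,
    Set.mem_union, Set.mem_image, Set.mem_iUnion, exists_prop]
  constructor
  · rintro ⟨⟨hx, hs⟩, hne⟩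
    by_cases hxe : x = e
    · subst hxe
      exact .inl ⟨s, ⟨hs, fun h => hne ⟨rfl, h⟩⟩, rfl, rfl⟩
    have hxF : x ∈ F.erase e := Finset.mem_erase.2 ⟨hxe, hx⟩
    by_cases hsu : s = u x
    · obtain ⟨y, hy, rfl⟩ := hσ.surjOn hxF
      exact .inr ⟨y, hy, .inr ⟨rfl, hsu⟩⟩
    · exact .inr ⟨x, hxF, .inl ⟨s, ⟨hs, hsu⟩, rfl, rfl⟩⟩
  · rintro (⟨_, ⟨hs, hne⟩, rfl, rfl⟩ | ⟨y, hy, ⟨_, ⟨hs, -⟩, rfl, rfl⟩ | ⟨rfl, rfl⟩⟩)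
    · exact ⟨⟨he, hs⟩, fun h => hne h.2⟩
    · exact ⟨⟨Finset.mem_of_mem_erase hy, hs⟩, fun h => Finset.ne_of_mem_erase hy h.1⟩
    · have hσy := hσ.mapsTo hy
      exact ⟨⟨Finset.mem_of_mem_erase hσy, hu _ hσy⟩, fun h => Finset.ne_of_mem_erase hσy h.1⟩

theorem pairwiseDisjoint_cons_image_union (J : Set α) (A : α → Set (List α)) {σ : Equiv.Perm α}
    (u : α → List α) :
    J.PairwiseDisjoint fun x => List.cons x '' (A x \ {u x}) ∪ {σ x :: u (σ x)} := by
  refine fun x _ y _ hxy => Set.disjoint_left.2 ?_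
  rintro _ (⟨s, ⟨-, hs⟩, rfl⟩ | rfl) (⟨t, ⟨-, ht⟩, h⟩ | h)
  · exact hxy (List.cons.inj h).1.symm
  · obtain ⟨rfl, rfl⟩ := List.cons.inj h
    exact hs rfl
  · obtain ⟨rfl, rfl⟩ := List.cons.inj h
    exact ht rfl
  · exact hxy (σ.injective (List.cons.inj h).1)

theorem exists_arrangements_sdiff_pair [DecidableEq α] {G : Finset α} {l : ℕ} (hl : 2 ≤ l)
    (hG : G.card = l + 2) {σ : Equiv.Perm α} (hσ : Set.BijOn σ G G)
    (hσne : ∀ x ∈ G, σ x ≠ x ∧ σ (σ x) ≠ x) (t : List α) :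
    ∃ u : α → List α, ∀ x ∈ G,
      u (σ x) ∈ arrangements (G \ {x, σ x}) l ∧ u (σ x) ≠ t ∧ u (σ x) ≠ u x := by
  have hcard {x : α} (hx : x ∈ G) : (G \ {x, σ x}).card = l := by
    rw [Finset.card_sdiff_of_subset (Finset.insert_subset hx
      (Finset.singleton_subset_iff.2 (hσ.mapsTo hx))), Finset.card_pair (hσne x hx).1.symm, hG]
    rfl
  have hv (x : α) : ∃ s, x ∈ G → s ∈ arrangements (G \ {x, σ x}) l ∧ s ≠ t := by
    by_cases hx : x ∈ G
    · obtain ⟨s, hs, hst⟩ := exists_mem_arrangements_ne (hl.trans (hcard hx).ge) t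
      exact ⟨s, fun _ => ⟨hcard hx ▸ hs, hst⟩⟩
    · exact ⟨[], fun h => absurd h hx⟩
  choose v hv using hv
  refine ⟨fun x => v (σ.symm x), fun x hx => ?_⟩
  simp only [σ.symm_apply_apply]
  refine ⟨(hv x hx).1, (hv x hx).2, fun h => ?_⟩
  obtain ⟨y, hy, rfl⟩ := hσ.surjOn hx
  rw [σ.symm_apply_apply] at h
  have hmem : σ (σ y) ∈ v y := mem_of_mem_arrangements ((hcard hy).symm ▸ (hv y hy).1)
    (by simpa [hσne y hy, hσne (σ y) hx] using hσ.mapsTo hx)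
  exact (Finset.mem_sdiff.1 ((hv _ hx).1.2.2 _ (h ▸ hmem))).2 (by simp)

theorem IsHyperTree.arrangements_succ [DecidableEq α] {F : Finset α} {l : ℕ} (hl : 2 ≤ l)
    (hF : F.card = l + 3) {e : α} (he : e ∈ F) {t : List α}
    (ht : t ∈ arrangements (F.erase e) l)
    (ih : ∀ x ∈ F, ∀ v ∈ arrangements (F.erase x) l,
      IsHyperTree DifferInOnePlace (arrangements (F.erase x) l \ {v})) :
    IsHyperTree DifferInOnePlace (arrangements F (l + 1) \ {e :: t}) := by
  have hG : (F.erase e).card = l + 2 := by rw [Finset.card_erase_of_mem he, hF]; rfl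
  obtain ⟨σ, hσ, hσne⟩ := exists_perm_bijOn_no_short_cycles (F := F.erase e) (by lia)
  obtain ⟨u, hu⟩ := exists_arrangements_sdiff_pair hl hG hσ hσne t
  have hu_erase : ∀ x ∈ F.erase e, u x ∈ arrangements (F.erase x) l := by
    intro x hx
    obtain ⟨y, hy, rfl⟩ := hσ.surjOn hx
    exact arrangements_mono (by grind) l (hu y hy).1
  have hcons {S : Set (List α)} (hS : IsHyperTree DifferInOnePlace S) (x : α) :
      IsHyperTree DifferInOnePlace (List.cons x '' S) :=
    hS.image List.cons_injective.injOn fun _ _ _ h => h.cons x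
  rw [arrangements_sdiff_eq_union he t hσ hu_erase]
  refine (hcons (ih e he t ht) e).union_biUnion (F.erase e).finite_toSet
    (fun x hx => hcons (ih x (Finset.mem_of_mem_erase hx) _ (hu_erase x hx)) x)
    (fun x _ => .singleton (σ x :: u (σ x))) (fun x hx => ?_) (fun x hx => ?_)
    (pairwiseDisjoint_cons_image_union _ _ u) (fun x hx => ?_)
  · rw [Set.disjoint_singleton_right]
    rintro ⟨s, -, hs⟩
    exact (hσne x hx).1 (List.cons.inj hs).1.symm
  · refine Set.disjoint_left.2 ?_
    rintro _ ⟨s, -, rfl⟩ (⟨s', -, hs'⟩ | hs')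
    · exact Finset.ne_of_mem_erase hx (List.cons.inj hs').1
    · exact Finset.ne_of_mem_erase (hσ.mapsTo hx) (List.cons.inj hs').1.symm
  · obtain ⟨humem, hut, hux⟩ := hu x hx
    exact ⟨e :: u (σ x), ⟨_, ⟨arrangements_mono Finset.sdiff_subset l humem, hut⟩, rfl⟩,
      x :: u (σ x), ⟨_, ⟨arrangements_mono (by grind) l humem, hux⟩, rfl⟩, _, rfl,
      .head (Finset.ne_of_mem_erase hx).symm (Finset.ne_of_mem_erase (hσ.mapsTo hx)).symm
        (hσne x hx).1.symm _⟩

theorem isHyperTree_arrangements {l : ℕ} (hl : 2 ≤ l) {F : Finset α}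
    (hF : F.card = l + 2) {w : List α} (hw : w ∈ arrangements F l) :
    IsHyperTree DifferInOnePlace (arrangements F l \ {w}) := by
  classical
  induction l, hl using Nat.le_induction generalizing F w with
  | base =>
    obtain ⟨c, d, rfl⟩ := List.length_eq_two.1 hw.2.1
    obtain ⟨hc, hd, -⟩ : c ∈ F ∧ d ∈ F.erase c ∧ _ := by
      simpa only [cons_mem_arrangements] using hw
    obtain ⟨a, b, hab, hFab⟩ : ∃ a b, a ≠ b ∧ (F.erase c).erase d = {a, b} := by
      rw [← Finset.card_eq_two, Finset.card_erase_of_mem hd, Finset.card_erase_of_mem hc, hF]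
    have hFabcd : F = {a, b, c, d} := by
      rw [← Finset.insert_erase hc, ← Finset.insert_erase hd, hFab]
      grind
    rw [hFabcd]
    exact isHyperTree_arrangements_two (by grind)
  | succ l hl ih =>
    obtain ⟨e, t, rfl⟩ := List.exists_cons_of_length_eq_add_one hw.2.1
    rw [cons_mem_arrangements] at hw
    refine .arrangements_succ hl hF hw.1 hw.2 fun x hx v hv => ih ?_ hv
    rw [Finset.card_erase_of_mem hx, hF]
    rfl

end Arrangements

section CyclicArrangements

variable {α : Type*}

/-- The hyperedges on cyclic arrangements: three cycles that agree except for three different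
entries in one place. -/
def CyclesDifferInOnePlace (P Q R : Cycle α) : Prop :=
  ∃ p q r : List α, DifferInOnePlace p q r ∧ P = p ∧ Q = q ∧ R = r

theorem coe_cons_inj {x : α} {s t : List α} (hs : (x :: s).Nodup) :
    ((x :: s : List α) : Cycle α) = (x :: t : List α) ↔ s = t := by
  refine ⟨fun h => ?_, by rintro rfl; rfl⟩
  obtain ⟨k, hk⟩ := Cycle.coe_eq_coe.1 h
  have hlen : 0 < (x :: s).length := by simp
  rw [← List.rotate_mod] at hk
  have hx : (x :: s)[k % (x :: s).length]'(Nat.mod_lt _ hlen) = (x :: s)[0] := by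
    have := List.head?_rotate (Nat.mod_lt k hlen)
    rw [hk, List.getElem?_eq_getElem (Nat.mod_lt k hlen)] at this
    simpa using this.symm
  rw [hs.getElem_inj_iff] at hx
  rw [hx] at hk
  simpa using hk

theorem nodup_cons_of_mem_arrangements {F : Finset α} {x : α} (hx : x ∉ F) {s : List α} {l : ℕ}
    (hs : s ∈ arrangements F l) : (x :: s).Nodup :=
  List.nodup_cons.2 ⟨fun h => hx (hs.2.2 x h), hs.1⟩

theorem isHyperTree_image_coe_cons {F : Finset α} {l : ℕ} (hl : 2 ≤ l) (hF : F.card = l + 2)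
    {x : α} (hx : x ∉ F) {w : List α} (hw : w ∈ arrangements F l) :
    IsHyperTree CyclesDifferInOnePlace
      ((fun s : List α => ((x :: s : List α) : Cycle α)) '' (arrangements F l \ {w})) :=
  (isHyperTree_arrangements hl hF hw).image
    (fun _ hs _ _ h => (coe_cons_inj (nodup_cons_of_mem_arrangements hx hs.1)).1 h)
    fun _ _ _ h => ⟨_, _, _, h.cons x, rfl, rfl, rfl⟩

theorem exists_coe_cons_eq {C : Cycle α} {x : α} (hx : x ∈ C) :
    ∃ s : List α, C = (x :: s : List α) := by
  induction C using Quotient.inductionOn with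
  | _ L =>
  obtain ⟨s, t, rfl⟩ := List.append_of_mem (Cycle.mem_coe_iff.1 hx)
  exact ⟨t ++ s, Cycle.coe_eq_coe.2 (by simpa using List.isRotated_append (l := s) (l' := x :: t))⟩

section Pairs

variable [DecidableEq α] {G : Finset α} {I : Type*} (f : I × Bool ≃ G)

/-- The elements of `G` outside the `i`-th of the pairs into which `f` splits `G`. -/
def outsidePair (i : I) : Finset α :=
  G \ Finset.univ.image fun b => (f (i, b) : α)

variable {f}

theorem mem_outsidePair {i : I} {y : α} :
    y ∈ outsidePair f i ↔ y ∈ G ∧ ∀ b, y ≠ f (i, b) := by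
  simp only [outsidePair, Finset.mem_sdiff, Finset.mem_image, Finset.mem_univ, true_and, ne_eq,
    not_exists, eq_comm]

theorem card_outsidePair {l : ℕ} (hG : G.card = l + 2) (i : I) :
    (outsidePair f i).card = l := by
  rw [outsidePair, Finset.card_sdiff_of_subset, Finset.card_image_of_injective,
    Finset.card_univ, Fintype.card_bool, hG, Nat.add_sub_cancel]
  · exact fun b c h => (Prod.mk.inj (f.injective (Subtype.ext h))).2
  · exact Finset.image_subset_iff.2 fun b _ => (f (i, b)).2

theorem apply_not_notMem_cons {i : I} {b : Bool} {s : List α} {l : ℕ}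
    (hs : s ∈ arrangements (outsidePair f i) l) : (f (i, !b) : α) ∉ (f (i, b) : α) :: s := by
  rw [List.mem_cons, not_or]
  exact ⟨by simp, fun h => (mem_outsidePair.1 (hs.2.2 _ h)).2 _ rfl⟩

theorem mem_cons_of_ne_apply_not {l : ℕ} (hG : G.card = l + 2) {i : I} {b : Bool} {s : List α}
    (hs : s ∈ arrangements (outsidePair f i) l) {y : α} (hy : y ∈ G)
    (hne : y ≠ f (i, !b)) : y ∈ (f (i, b) : α) :: s := by
  rw [List.mem_cons, or_iff_not_imp_left]
  refine fun hyb => mem_of_mem_arrangements (F := outsidePair f i) (by rwa [card_outsidePair hG])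
    (mem_outsidePair.2 ⟨hy, fun c => ?_⟩)
  rcases Bool.eq_or_eq_not c b with rfl | rfl <;> assumption

theorem nodup_cons_of_mem_arrangements_outsidePair {i : I} (b : Bool) {s : List α} {l : ℕ}
    (hs : s ∈ arrangements (outsidePair f i) l) : ((f (i, b) : α) :: s).Nodup :=
  nodup_cons_of_mem_arrangements (fun h => (mem_outsidePair.1 h).2 b rfl) hs

theorem coe_cons_apply_inj {l : ℕ} (hG : G.card = l + 2) {i j : I} {b c : Bool} {s t : List α}
    (hs : s ∈ arrangements (outsidePair f i) l)
    (ht : t ∈ arrangements (outsidePair f j) l)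
    (h : (((f (i, b) : α) :: s : List α) : Cycle α) = ((f (j, c) : α) :: t : List α)) :
    (i = j ∧ b = c) ∧ s = t := by
  have hij : i = j ∧ b = c := by
    by_contra hne
    have hmem : (f (i, !b) : α) ∈ (f (j, c) : α) :: t := by
      refine mem_cons_of_ne_apply_not hG ht (f (i, !b)).2 fun h' => hne ?_
      simpa [Subtype.val_inj] using h'
    rw [← Cycle.mem_coe_iff, ← h, Cycle.mem_coe_iff] at hmem
    exact apply_not_notMem_cons hs hmem
  obtain ⟨rfl, rfl⟩ := hij
  exact ⟨⟨rfl, rfl⟩, (coe_cons_inj (nodup_cons_of_mem_arrangements_outsidePair b hs)).1 h⟩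

theorem exists_coe_cons_apply_eq {l : ℕ} (hG : G.card = l + 2) {C : Cycle α} (hC : C.Nodup)
    (hlen : C.length = l + 1) (hCG : ∀ x ∈ C, x ∈ G) :
    ∃ i b, ∃ s ∈ arrangements (outsidePair f i) l,
      C = ((f (i, b) : α) :: s : List α) := by
  induction C using Quotient.inductionOn with
  | _ L =>
  have hLG : L.toFinset ⊆ G := fun x hx => hCG x (Cycle.mem_coe_iff.2 (List.mem_toFinset.1 hx))
  have hcard : L.toFinset.card + 1 = G.card := by
    rw [List.toFinset_card_of_nodup (Cycle.nodup_coe_iff.1 hC), hG]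
    exact congrArg (· + 1) hlen
  obtain ⟨y, hyG, hyL⟩ := Finset.exists_mem_notMem_of_card_lt_card (s := L.toFinset) (t := G)
    (by lia)
  have hL : L.toFinset = G.erase y := Finset.eq_of_subset_of_card_le
    (Finset.subset_erase.2 ⟨hLG, hyL⟩) (by rw [Finset.card_erase_of_mem hyG]; lia)
  have hmem {x : α} : x ∈ (L : Cycle α) ↔ x ≠ y ∧ x ∈ G := by
    rw [Cycle.mem_coe_iff, ← List.mem_toFinset, hL, Finset.mem_erase]
  obtain ⟨⟨i, b⟩, hib⟩ := f.surjective ⟨y, hyG⟩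
  obtain rfl : (f (i, b) : α) = y := congrArg Subtype.val hib
  obtain ⟨s, hs⟩ := exists_coe_cons_eq (hmem.2 ⟨by simp, (f (i, !b)).2⟩)
  change (L : Cycle α).Nodup at hC
  change (L : Cycle α).length = _ at hlen
  rw [hs] at hC hlen hmem
  rw [Cycle.nodup_coe_iff, List.nodup_cons] at hC
  rw [Cycle.length_coe, List.length_cons] at hlen
  refine ⟨i, !b, s, ⟨hC.2, by lia, fun x hx => ?_⟩, hs⟩
  have hx' := hmem.1 (Cycle.mem_coe_iff.2 (List.mem_cons_of_mem _ hx))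
  refine mem_outsidePair.2 ⟨hx'.2, fun c => ?_⟩
  rcases Bool.eq_or_eq_not c b with rfl | rfl
  · exact hx'.1
  · rintro rfl
    exact hC.1 hx

theorem notMem_coe_cons_apply {o : α} (ho : o ∉ G) {i : I} (b : Bool) {s : List α} {l : ℕ}
    (hs : s ∈ arrangements (outsidePair f i) l) :
    o ∉ (((f (i, b) : α) :: s : List α) : Cycle α) := by
  rw [Cycle.mem_coe_iff, List.mem_cons, not_or]
  exact ⟨fun h => ho (h ▸ (f (i, b)).2), fun h => ho (mem_outsidePair.1 (hs.2.2 o h)).1⟩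

theorem nodup_length_sdiff_eq_union [Fintype α] {o : α} {f : I × Bool ≃ Finset.univ.erase o}
    {l : ℕ} (hα : Fintype.card α = l + 3) {w : List α} :
    {C : Cycle α | C.Nodup ∧ C.length = l + 1} \ {((o :: w : List α) : Cycle α)} =
      (fun s : List α => ((o :: s : List α) : Cycle α)) ''
        (arrangements (Finset.univ.erase o) l \ {w}) ∪
      ⋃ p ∈ {p : I × List α | p.2 ∈ arrangements (outsidePair f p.1) l},
        ({(((f (p.1, false) : α) :: p.2 : List α) : Cycle α)} ∪
          {(((f (p.1, true) : α) :: p.2 : List α) : Cycle α)}) := by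
  have hG : (Finset.univ.erase o).card = l + 2 := by
    rw [Finset.card_erase_of_mem (Finset.mem_univ o), Finset.card_univ, hα]; rfl
  have hmem (i : I) (b : Bool) {s : List α} (hs : s ∈ arrangements (outsidePair f i) l) :
      (((f (i, b) : α) :: s : List α) : Cycle α) ∈
        {C : Cycle α | C.Nodup ∧ C.length = l + 1} \ {((o :: w : List α) : Cycle α)} := by
    refine ⟨⟨Cycle.nodup_coe_iff.2 (nodup_cons_of_mem_arrangements_outsidePair b hs),
      by simp [hs.2.1]⟩, fun h => notMem_coe_cons_apply (Finset.notMem_erase o _) b hs ?_⟩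
    rw [Set.mem_singleton_iff.1 h, Cycle.mem_coe_iff]
    exact List.mem_cons_self
  ext C
  simp only [Set.mem_union, Set.mem_iUnion, Set.mem_image, Set.mem_singleton_iff]
  constructor
  · rintro ⟨⟨hC, hlen⟩, hne⟩
    by_cases ho : o ∈ C
    · obtain ⟨s, rfl⟩ := exists_coe_cons_eq ho
      rw [Cycle.nodup_coe_iff, List.nodup_cons] at hC
      refine .inl ⟨s, ⟨⟨hC.2, by simpa using hlen, fun x hx => ?_⟩, fun h => hne (h ▸ rfl)⟩, rfl⟩
      simpa using ne_of_mem_of_not_mem hx hC.1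
    · obtain ⟨i, b, s, hs, rfl⟩ := exists_coe_cons_apply_eq (f := f) hG hC hlen
        fun x hx => by simpa using ne_of_mem_of_not_mem hx ho
      exact .inr ⟨(i, s), hs, by cases b <;> simp⟩
  · rintro (⟨s, ⟨hs, hne⟩, rfl⟩ | ⟨⟨i, s⟩, hs, rfl | rfl⟩)
    · have hos : (o :: s).Nodup := nodup_cons_of_mem_arrangements (Finset.notMem_erase o _) hs
      exact ⟨⟨Cycle.nodup_coe_iff.2 hos, by simp [hs.2.1]⟩,
        fun h => hne ((coe_cons_inj hos).1 h)⟩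
    · exact hmem i false hs
    · exact hmem i true hs

theorem exists_mem_arrangements_notMem_outsidePair {l : ℕ} (hG : G.card = l + 2)
    (h : 2 ≤ Nat.card I) :
    ∃ w ∈ arrangements G l, ∀ i, w ∉ arrangements (outsidePair f i) l := by
  have : Finite I := Nat.finite_of_card_ne_zero (by lia)
  obtain ⟨i, j, hij⟩ := (Finite.one_lt_card_iff_nontrivial.1 h).exists_pair_ne
  have hne : (f (i, true) : α) ≠ f (j, true) := by simpa [Subtype.val_inj] using hij
  refine ⟨((G.erase (f (i, true))).erase (f (j, true))).toList,
    ⟨Finset.nodup_toList _, ?_, fun x hx => ?_⟩, fun k hk => ?_⟩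
  · rw [Finset.length_toList, Finset.card_erase_of_mem (Finset.mem_erase.2 ⟨hne.symm, (f _).2⟩),
      Finset.card_erase_of_mem (f _).2, hG]
    rfl
  · rw [Finset.mem_toList] at hx
    exact Finset.mem_of_mem_erase (Finset.mem_of_mem_erase hx)
  · refine (mem_outsidePair.1 (hk.2.2 (f (k, false)) ?_)).2 false rfl
    simp

end Pairs

theorem exists_isHyperTree_cyclic [Fintype α] {l : ℕ} (hl : 2 ≤ l) (hl_even : Even l)
    (hα : Fintype.card α = l + 3) :
    ∃ C₀ : Cycle α, C₀.Nodup ∧ C₀.length = l + 1 ∧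
      IsHyperTree CyclesDifferInOnePlace ({C | C.Nodup ∧ C.length = l + 1} \ {C₀}) := by
  classical
  obtain ⟨o⟩ : Nonempty α := Fintype.card_pos_iff.1 (by lia)
  have hG : (Finset.univ.erase o).card = l + 2 := by
    rw [Finset.card_erase_of_mem (Finset.mem_univ o), Finset.card_univ, hα]; rfl
  obtain ⟨m, rfl⟩ := hl_even.two_dvd
  obtain ⟨f⟩ : Nonempty (Fin (m + 1) × Bool ≃ Finset.univ.erase o) := by
    rw [← Fintype.card_eq, Fintype.card_prod, Fintype.card_fin, Fintype.card_bool,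
      Fintype.card_coe, hG]
    ring
  obtain ⟨w, hw, hwf⟩ := exists_mem_arrangements_notMem_outsidePair (f := f) hG
    (by rw [Nat.card_fin]; lia)
  have ho : o ∉ Finset.univ.erase o := Finset.notMem_erase o _
  refine ⟨(o :: w : List α), Cycle.nodup_coe_iff.2 (nodup_cons_of_mem_arrangements ho hw),
    by simp [hw.2.1], ?_⟩
  rw [nodup_length_sdiff_eq_union (f := f) hα]
  refine (isHyperTree_image_coe_cons hl hG ho hw).union_biUnion ?_ (fun _ _ => .singleton _)
    (fun _ _ => .singleton _) (fun p hp => Set.disjoint_singleton.2 fun h => ?_)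
    (fun p hp => ?_) ?_ (fun p hp => ?_)
  · refine (Set.finite_univ.prod (finite_arrangements (Finset.univ.erase o) (2 * m))).subset ?_
    exact fun p hp => ⟨trivial, arrangements_mono Finset.sdiff_subset _ hp⟩
  · exact Bool.false_ne_true (coe_cons_apply_inj hG hp hp h).1.2
  · refine Set.disjoint_left.2 ?_
    rintro C ⟨s, -, hs⟩ hC
    have hoC : o ∈ C := hs ▸ Cycle.mem_coe_iff.2 List.mem_cons_self
    rcases hC with rfl | rfl <;> exact notMem_coe_cons_apply ho _ hp hoC
  · refine fun p hp q hq hpq => Set.disjoint_left.2 ?_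
    rintro _ (rfl | rfl) (h | h) <;>
    · obtain ⟨⟨hi, -⟩, hs⟩ := coe_cons_apply_inj hG hp hq h
      exact hpq (Prod.ext hi hs)
  · refine ⟨_, ⟨p.2, ⟨arrangements_mono Finset.sdiff_subset _ hp, fun h => hwf p.1 (h ▸ hp)⟩, rfl⟩,
      _, rfl, _, rfl, _, _, _, .head (x := o) ?_ ?_ ?_ p.2, rfl, rfl, rfl⟩
    · exact (Finset.ne_of_mem_erase (f _).2).symm
    · exact (Finset.ne_of_mem_erase (f _).2).symm
    · simp

end CyclicArrangements

section Switching

open scoped Pointwise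

variable {G : Type*} [Group G]

theorem rel_pow_mul {R : G → G → Prop} {ρ : G} (hR : ∀ u v, R u v → R (ρ * u) (ρ * v)) (i : ℕ)
    {u v : G} (h : R u v) : R (ρ ^ i * u) (ρ ^ i * v) := by
  induction i with
  | zero => simpa using h
  | succ i ih => simpa only [pow_succ', mul_assoc] using hR _ _ ih

theorem HasHamiltonianPath.biUnion_pow_smul {R : G → G → Prop} {B : Set G} {x y ρ : G}
    (hR : ∀ u v, R u v → R (ρ * u) (ρ * v)) (hB : HasHamiltonianPath R B x y)
    (hy : R y (ρ * x)) {k : ℕ} (hdisj : (Set.Iic k).PairwiseDisjoint fun i => ρ ^ i • B) :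
    HasHamiltonianPath R (⋃ i ∈ Set.Iic k, ρ ^ i • B) x (ρ ^ k * y) := by
  induction k with
  | zero => simpa using hB
  | succ k ih =>
    have hIic : Set.Iic (k + 1) = insert (k + 1) (Set.Iic k) := Order.Iic_succ k
    rw [hIic, Set.pairwiseDisjoint_insert_of_notMem (by simp)] at hdisj
    rw [hIic, Set.biUnion_insert, Set.union_comm]
    refine (ih hdisj.1).append
      (hB.image (mul_right_injective (ρ ^ (k + 1))) fun u v => rel_pow_mul hR (k + 1))
      (Set.disjoint_iUnion₂_left.2 fun i hi => (hdisj.2 i hi).symm) ?_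
    simpa only [pow_succ, mul_assoc, smul_eq_mul] using rel_pow_mul hR k hy

theorem HasHamiltonianPath.hasHamiltonianCycle_biUnion_pow_smul {R : G → G → Prop} {B : Set G}
    {x y ρ : G} (hR : ∀ u v, R u v → R (ρ * u) (ρ * v)) (hB : HasHamiltonianPath R B x y)
    (hy : R y (ρ * x)) {k : ℕ} (hk : ρ ^ (k + 1) = 1)
    (hdisj : (Set.Iic k).PairwiseDisjoint fun i => ρ ^ i • B) :
    HasHamiltonianCycle R (⋃ i ∈ Set.Iic k, ρ ^ i • B) := by
  refine (hB.biUnion_pow_smul hR hy hdisj).hasHamiltonianCycle ?_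
  simpa only [← mul_assoc, ← pow_succ, hk, one_mul] using rel_pow_mul hR k hy

/-- The moves from `x` to `x * a` anywhere, and from `x` to `x * b` where `x * (a * b⁻¹)` lies in
`S`. For `x * b = x * (a * b⁻¹)⁻¹ * a` such a switch leaves the coset `x⟨a⟩`. -/
def SwitchStep (a b : G) (S : Set G) (x y : G) : Prop :=
  y = x * a ∨ y = x * b ∧ x * (a * b⁻¹) ∈ S

/-- The sets `S` that are traversed by a cycle of moves `x ↦ x * a` and of switches `x ↦ x * b`, the
latter only at those `x` for which `x * (a * b⁻¹)` lies in `S` as well. -/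
def Traversable (a b : G) (S : Set G) : Prop :=
  HasHamiltonianCycle (SwitchStep a b S) S

variable {a b : G} {S T U : Set G}

theorem SwitchStep.mono (hST : S ⊆ T) {x y : G} (h : SwitchStep a b S x y) :
    SwitchStep a b T x y :=
  h.imp_right (And.imp_right (@hST _))

theorem Traversable.path (hS : Traversable a b S) {g : G} (hg : g ∈ S)
    (hgc : g * (a * b⁻¹) ∉ S) : HasHamiltonianPath (SwitchStep a b S) S (g * a) g := by
  obtain ⟨y, -, rfl | hy, h⟩ := hS.exists_path hg
  · exact h
  · exact absurd hy.2 hgc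

/-- Opened at `g`, `g * c` and `g * c * c`, where `c = a * b⁻¹`, the three cycles are joined by the
switches at these places, since `g * b = g * c * c * a` etc. -/
theorem Traversable.merge (hc : (a * b⁻¹) ^ 3 = 1) (hS : Traversable a b S)
    (hT : Traversable a b T) (hU : Traversable a b U) (hST : Disjoint S T) (hSU : Disjoint S U)
    (hTU : Disjoint T U) {g : G} (hgS : g ∈ S) (hgT : g * (a * b⁻¹) ∈ T)
    (hgU : g * (a * b⁻¹) * (a * b⁻¹) ∈ U) : Traversable a b (S ∪ (T ∪ U)) := by
  have hb (x : G) : x * b = x * (a * b⁻¹) * (a * b⁻¹) * a := by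
    rw [← mul_left_inj (a⁻¹ * (a * b⁻¹)), mul_assoc _ a, mul_inv_cancel_left]
    simp only [mul_assoc x, ← pow_three', hc]
    group
  have hg : g * (a * b⁻¹) * (a * b⁻¹) * (a * b⁻¹) = g := by
    simpa only [pow_three', mul_assoc, mul_one] using congrArg (g * ·) hc
  have hpS := (hS.path hgS fun h => hST.ne_of_mem h hgT rfl).mono fun _ _ =>
    SwitchStep.mono (T := S ∪ (T ∪ U)) Set.subset_union_left
  have hpT := (hT.path hgT fun h => hTU.ne_of_mem h hgU rfl).mono fun _ _ =>
    SwitchStep.mono (T := S ∪ (T ∪ U)) (Set.subset_union_left.trans Set.subset_union_right)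
  have hpU := (hU.path hgU fun h => hSU.ne_of_mem hgS h hg.symm).mono fun _ _ =>
    SwitchStep.mono (T := S ∪ (T ∪ U)) (Set.subset_union_right.trans Set.subset_union_right)
  have hpSU := hpS.append hpU hSU (.inr ⟨(hb g).symm, .inr (.inl hgT)⟩)
  have hpSUT := hpSU.append hpT (hST.union_left hTU.symm)
    (.inr ⟨by rw [hb, hg], .inl (hg.symm ▸ hgS)⟩)
  rw [Set.union_comm T U, ← Set.union_assoc] at hpSUT ⊢
  exact hpSUT.hasHamiltonianCycle (.inr ⟨by rw [hb, hg], .inl (.inr hgU)⟩)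

theorem traversable_leftCoset (ha : IsOfFinOrder a) (g : G) :
    Traversable a b {x | g⁻¹ * x ∈ Subgroup.zpowers a} := by
  classical
  obtain ⟨k, hk⟩ := Nat.exists_eq_add_one.2 ha.orderOf_pos
  have hpow (i : ℕ) : (g * a * g⁻¹) ^ i • ({g} : Set G) = {g * a ^ i} := by
    rw [conj_pow, Set.smul_set_singleton, smul_eq_mul, inv_mul_cancel_right]
  have hset : ⋃ i ∈ Set.Iic k, (g * a * g⁻¹) ^ i • ({g} : Set G) =
      {x | g⁻¹ * x ∈ Subgroup.zpowers a} := by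
    ext x
    simp only [hpow, ← ha.mem_powers_iff_mem_zpowers, ha.mem_powers_iff_mem_range_orderOf, hk,
      Set.mem_iUnion, Set.mem_Iic, Set.mem_singleton_iff, Set.mem_ofPred_eq, Finset.mem_image,
      Finset.mem_range_succ_iff, exists_prop, eq_inv_mul_iff_mul_eq, @eq_comm _ x]
  have hcycle := (HasHamiltonianPath.singleton g).hasHamiltonianCycle_biUnion_pow_smul
    (R := fun x y => y = x * a) (ρ := g * a * g⁻¹) (k := k)
    (fun u v h => by rw [h, mul_assoc (g * a * g⁻¹)]) (by group)
    (by rw [conj_pow, ← hk, pow_orderOf_eq_one]; group) fun i hi j hj hij => ?_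
  · rw [hset] at hcycle
    exact hcycle.mono fun _ _ => .inl
  · rw [← Set.Iio_add_one_eq_Iic, ← hk] at hi hj
    simpa only [hpow, Function.onFun, Set.disjoint_singleton, ne_eq, mul_right_inj] using
      fun h => hij (pow_injOn_Iio_orderOf hi hj h)

theorem Traversable.of_isHyperTree {V : Type*} {E : V → V → V → Prop} {κ : G → V}
    (ha : IsOfFinOrder a) (hc : (a * b⁻¹) ^ 3 = 1)
    (hκ : ∀ g h, κ g = κ h ↔ g⁻¹ * h ∈ Subgroup.zpowers a)
    (hE : ∀ g h k, E (κ g) (κ h) (κ k) → ∃ g', κ g' = κ g ∧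
      (κ (g' * (a * b⁻¹)) = κ h ∧ κ (g' * (a * b⁻¹) * (a * b⁻¹)) = κ k ∨
        κ (g' * (a * b⁻¹)) = κ k ∧ κ (g' * (a * b⁻¹) * (a * b⁻¹)) = κ h))
    {S : Set V} (hS : IsHyperTree E S) (hSκ : S ⊆ Set.range κ) : Traversable a b (κ ⁻¹' S) := by
  induction hS with
  | singleton v =>
    obtain ⟨g, rfl⟩ := hSκ rfl
    convert traversable_leftCoset ha g using 1
    ext x
    exact eq_comm.trans (hκ g x)
  | @join S T U p q r _ _ _ hST hSU hTU hp hq hr hpqr ihS ihT ihU =>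
    obtain ⟨hS, hT, hU⟩ : S ⊆ Set.range κ ∧ T ⊆ Set.range κ ∧ U ⊆ Set.range κ := by
      simpa only [Set.union_subset_iff] using hSκ
    have hST' := hST.preimage κ
    have hSU' := hSU.preimage κ
    have hTU' := hTU.preimage κ
    simp only [Set.preimage_union]
    obtain ⟨p, rfl⟩ := hS hp
    obtain ⟨q, rfl⟩ := hT hq
    obtain ⟨r, rfl⟩ := hU hr
    obtain ⟨g, hgp, ⟨hgq, hgr⟩ | ⟨hgr, hgq⟩⟩ := hE p q r hpqr
    · exact (ihS hS).merge hc (ihT hT) (ihU hU) hST' hSU' hTU' (hgp ▸ hp :) (hgq ▸ hq :)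
        (hgr ▸ hr :)
    · rw [Set.union_comm (κ ⁻¹' T)]
      exact (ihS hS).merge hc (ihU hU) (ihT hT) hSU' hST' hTU'.symm (hgp ▸ hp :) (hgr ▸ hr :)
        (hgq ▸ hq :)

theorem Traversable.path_of_compl_leftCoset {g : G}
    (h : Traversable a b {x | g⁻¹ * x ∉ Subgroup.zpowers a}) (hb : b ∉ Subgroup.zpowers a) :
    HasHamiltonianPath (fun x y => y = x * a ∨ y = x * b) {x | b * x ∉ Subgroup.zpowers a}
      1 a⁻¹ := by
  have hg : g * b * a⁻¹ ∈ {x | g⁻¹ * x ∉ Subgroup.zpowers a} := by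
    simpa [mul_assoc, Subgroup.mul_mem_cancel_right] using hb
  convert (h.path hg (by simp)).image (mul_right_injective (g * b)⁻¹)
    (R' := fun x y => y = x * a ∨ y = x * b) fun u v huv => ?_ using 1
  · ext x
    rw [Set.image_mul_left]
    simp only [Set.mem_preimage, Set.mem_ofPred_eq, inv_inv, mul_assoc, inv_mul_cancel_left]
  · group
  · group
  · simp only [mul_assoc]
    exact huv.imp (congrArg _) fun h => congrArg _ h.1

theorem ncard_setOf_mul_notMem_zpowers_add_orderOf [Finite G] (a b : G) :
    {x | b * x ∉ Subgroup.zpowers a}.ncard + orderOf a = Nat.card G := by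
  have h : {x | b * x ∉ Subgroup.zpowers a} = ((b⁻¹ * ·) '' (Subgroup.zpowers a : Set G))ᶜ := by
    ext x
    simp [Set.image_mul_left]
  rw [h, ← Nat.card_zpowers, ← SetLike.coe_sort_coe, Nat.card_coe_set_eq,
    ← Set.ncard_image_of_injective (Subgroup.zpowers a : Set G) (mul_right_injective b⁻¹),
    add_comm, Set.ncard_add_ncard_compl]

end Switching

section EvenPushes

open Equiv

theorem val_cycleRange {n : ℕ} (j i : Fin n) : (j.cycleRange i : ℕ) =
    if (i : ℕ) < j then (i : ℕ) + 1 else if (i : ℕ) = j then 0 else i := by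
  rcases lt_or_ge j i with h | h
  · rw [Fin.cycleRange_of_gt h, if_neg (by lia), if_neg (by lia)]
  · rw [Fin.coe_cycleRange_of_le h]
    split_ifs <;> lia

theorem val_cycleRange_inv {n : ℕ} (j i : Fin n) : (j.cycleRange⁻¹ i : ℕ) =
    if (i : ℕ) = 0 then (j : ℕ) else if (i : ℕ) ≤ j then (i : ℕ) - 1 else i := by
  obtain ⟨k, rfl⟩ := j.cycleRange.surjective i
  rw [← Perm.mul_apply, inv_mul_cancel, Perm.one_apply, val_cycleRange]
  split_ifs <;> lia

/-- The permutation by which `pushToTop j` multiplies, for an index `j` at which it is even. -/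
def evenPush {n : ℕ} (j : Fin n) (hj : Even (j : ℕ)) : alternatingGroup (Fin n) :=
  ⟨(Fin.cycleRange j)⁻¹, by
    rw [Perm.mem_alternatingGroup, Perm.sign_inv, Fin.sign_cycleRange, hj.neg_one_pow]⟩

theorem orderOf_evenPush {n : ℕ} {j : Fin (n + 1)} (hj : Even (j : ℕ)) (hj0 : j ≠ 0) :
    orderOf (evenPush j hj) = j + 1 := by
  rw [← Subgroup.orderOf_coe, evenPush, orderOf_inv, ← Perm.lcm_cycleType,
    Fin.cycleType_cycleRange hj0, Multiset.lcm_singleton, normalize_eq]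

theorem eq_one_of_card_support_le_two {α : Type*} [Fintype α] [DecidableEq α] {g : Perm α}
    (hsign : Perm.sign g = 1) (h : g.support.card ≤ 2) : g = 1 := by
  interval_cases hg : g.support.card
  · exact Perm.card_support_eq_zero.1 hg
  · exact absurd hg (Perm.card_support_ne_one g)
  · rw [(Perm.card_support_eq_two.1 hg).sign_eq] at hsign
    exact absurd hsign (by decide)

variable {l : ℕ}

/-- The first `l + 1` of the `l + 3` entries. -/
def initialEntries (g : alternatingGroup (Fin (l + 3))) : List (Fin (l + 3)) :=
  List.ofFn fun i : Fin (l + 1) => (g : Perm (Fin (l + 3))) (i.castAdd 2)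

theorem nodup_initialEntries (g : alternatingGroup (Fin (l + 3))) : (initialEntries g).Nodup :=
  List.nodup_ofFn.2 (g.1.injective.comp (Fin.castAdd_injective _ 2))

theorem length_initialEntries (g : alternatingGroup (Fin (l + 3))) :
    (initialEntries g).length = l + 1 :=
  List.length_ofFn

theorem initialEntries_injective : Function.Injective (initialEntries (l := l)) := by
  intro g h hgh
  have hfix (i : Fin (l + 1)) : (g⁻¹ * h).1 (i.castAdd 2) = i.castAdd 2 := by
    rw [Subgroup.coe_mul, Subgroup.coe_inv, Perm.mul_apply, Perm.inv_eq_iff_eq]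
    exact (congrFun (List.ofFn_injective hgh) i).symm
  have hsupp : (g⁻¹ * h).1.support ⊆ {Fin.last (l + 2), (Fin.last (l + 1)).castSucc} := by
    intro i hi
    rw [Perm.mem_support] at hi
    have hli : ¬ (i : ℕ) < l + 1 := fun hil => hi (hfix ⟨i, hil⟩)
    simp only [Finset.mem_insert, Finset.mem_singleton, Fin.ext_iff, Fin.val_last, Fin.val_castSucc]
    lia
  exact inv_mul_eq_one.1 (Subtype.ext (eq_one_of_card_support_le_two (g⁻¹ * h).2
    ((Finset.card_le_card hsupp).trans Finset.card_le_two)))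

theorem exists_initialEntries_eq {s : List (Fin (l + 3))} (hs : s.Nodup)
    (hlen : s.length = l + 1) : ∃ g, initialEntries g = s := by
  have : MulAction.IsMultiplyPretransitive (alternatingGroup (Fin (l + 3))) (Fin (l + 3))
      (l + 1) := by
    simpa using alternatingGroup.isMultiplyPretransitive (Fin (l + 3))
  obtain ⟨g, hg⟩ := MulAction.exists_smul_eq (alternatingGroup (Fin (l + 3)))
    (Fin.castAddEmb 2) ⟨fun i => s[i], fun i j h => Fin.ext (hs.getElem_inj_iff.1 h)⟩
  refine ⟨g, List.ext_getElem (by rw [length_initialEntries, hlen]) fun i hi _ => ?_⟩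
  rw [length_initialEntries] at hi
  rw [← show _ = s[i] from DFunLike.congr_fun hg ⟨i, hi⟩]
  exact List.getElem_ofFn _

/-- The even permutation of `l + 3` indices that is multiplied by when the entry at index `l` is
pushed to the top. -/
def shortPush (hl : Even l) : alternatingGroup (Fin (l + 3)) :=
  evenPush ((Fin.last l).castAdd 2) hl

/-- The even permutation of `l + 3` indices that is multiplied by when the last entry is pushed to
the top. -/
def longPush (hl : Even l) : alternatingGroup (Fin (l + 3)) :=
  evenPush (Fin.last (l + 2)) (hl.add even_two)

theorem initialEntries_mul_shortPush_inv_pow (hl : Even l) (g : alternatingGroup (Fin (l + 3)))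
    (n : ℕ) : initialEntries (g * (shortPush hl)⁻¹ ^ n) = (initialEntries g).rotate n := by
  induction n with
  | zero => simp
  | succ n ih =>
    rw [pow_succ, ← mul_assoc, ← List.rotate_rotate, ← ih]
    generalize g * (shortPush hl)⁻¹ ^ n = g
    refine List.ext_getElem (by simp [length_initialEntries]) fun i hi _ => ?_
    rw [length_initialEntries] at hi
    simp only [List.getElem_rotate, initialEntries, List.getElem_ofFn, List.length_ofFn,
      Subgroup.coe_mul, Perm.mul_apply]
    refine congrArg g.1 (Fin.ext ?_)
    simp only [shortPush, evenPush, Subgroup.coe_inv, inv_inv, val_cycleRange, Fin.val_castAdd,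
      Fin.val_last]
    split_ifs with h
    · exact (Nat.mod_eq_of_lt (by lia)).symm
    · rw [show i + 1 = l + 1 by lia, Nat.mod_self]
    · lia

/-- The cycle of the first `l + 1` entries, which determines the orbit under `shortPush`. -/
def initialCycle (g : alternatingGroup (Fin (l + 3))) : Cycle (Fin (l + 3)) :=
  initialEntries g

theorem initialCycle_eq_iff (hl : Even l) (g h : alternatingGroup (Fin (l + 3))) :
    initialCycle g = initialCycle h ↔ g⁻¹ * h ∈ Subgroup.zpowers (shortPush hl) := by
  rw [initialCycle, initialCycle, Cycle.coe_eq_coe, ← Subgroup.zpowers_inv,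
    ← mem_powers_iff_mem_zpowers]
  refine exists_congr fun n => ?_
  rw [← initialEntries_mul_shortPush_inv_pow hl, initialEntries_injective.eq_iff,
    eq_inv_mul_iff_mul_eq]

theorem range_initialCycle :
    Set.range (initialCycle (l := l)) = {C | C.Nodup ∧ C.length = l + 1} := by
  ext C
  constructor
  · rintro ⟨g, rfl⟩
    exact ⟨Cycle.nodup_coe_iff.2 (nodup_initialEntries g), length_initialEntries g⟩
  · rintro ⟨hC, hlen⟩
    induction C using Quotient.inductionOn with
    | _ L =>
    exact (exists_initialEntries_eq (Cycle.nodup_coe_iff.1 hC) hlen).imp fun g hg => congrArg _ hg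

theorem val_shortPush_mul_longPush_inv (hl : Even l) (i : Fin (l + 3)) :
    ((shortPush hl * (longPush hl)⁻¹).1 i : ℕ) =
      if (i : ℕ) = l then l + 1 else if (i : ℕ) = l + 1 then l + 2 else
        if (i : ℕ) = l + 2 then l else i := by
  simp only [shortPush, longPush, evenPush, Subgroup.coe_mul, Subgroup.coe_inv, inv_inv,
    Perm.mul_apply, val_cycleRange_inv, val_cycleRange, Fin.val_castAdd, Fin.val_last]
  split_ifs <;> lia

theorem shortPush_mul_longPush_inv_pow_three (hl : Even l) :
    (shortPush hl * (longPush hl)⁻¹) ^ 3 = 1 := by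
  ext i
  simp only [pow_three, Subgroup.coe_mul (alternatingGroup _) (shortPush hl * (longPush hl)⁻¹),
    Perm.mul_apply, val_shortPush_mul_longPush_inv]
  simp only [Subgroup.coe_one, Perm.one_apply]
  split_ifs <;> lia

theorem longPush_notMem_zpowers_shortPush (hl : Even l) :
    longPush hl ∉ Subgroup.zpowers (shortPush hl) := by
  intro h
  rw [← one_mul (longPush hl), ← inv_one, ← initialCycle_eq_iff] at h
  have hmem : Fin.last (l + 2) ∈ initialEntries (longPush hl) :=
    List.mem_ofFn.2 ⟨0, Fin.ext (val_cycleRange_inv _ _)⟩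
  rw [← Cycle.mem_coe_iff, ← initialCycle, ← h, initialCycle, Cycle.mem_coe_iff, initialEntries,
    List.mem_ofFn] at hmem
  obtain ⟨i, hi⟩ := hmem
  have hval := congrArg Fin.val hi
  rw [Subgroup.coe_one, Perm.one_apply, Fin.val_castAdd, Fin.val_last] at hval
  lia

theorem eq_or_eq_of_notMem_initialEntries {g : alternatingGroup (Fin (l + 3))} {y : Fin (l + 3)}
    (hy : y ∉ initialEntries g) :
    y = g.1 (Fin.natAdd (l + 1) (0 : Fin 2)) ∨ y = g.1 (Fin.natAdd (l + 1) (1 : Fin 2)) := by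
  obtain ⟨i, rfl⟩ := g.1.surjective y
  induction i using Fin.addCases (m := l + 1) (n := 2) with
  | left i => exact absurd (List.mem_ofFn.2 ⟨i, rfl⟩) hy
  | right i => fin_cases i <;> simp

theorem initialEntries_mul_eq_concat (hl : Even l) {g : alternatingGroup (Fin (l + 3))}
    {s : List (Fin (l + 3))} {x : Fin (l + 3)} (h : initialEntries g = s ++ [x]) :
    initialEntries (g * (shortPush hl * (longPush hl)⁻¹)) =
      s ++ [g.1 (Fin.natAdd (l + 1) (0 : Fin 2))] := by
  have hs : s.length = l := by simpa [length_initialEntries] using (congrArg List.length h).symm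
  refine List.ext_getElem (by simp [length_initialEntries, hs]) fun i hi _ => ?_
  rw [length_initialEntries] at hi
  simp only [initialEntries, List.getElem_ofFn, Subgroup.coe_mul _ g, Perm.mul_apply]
  rcases Nat.lt_succ_iff_lt_or_eq.1 hi with hil | rfl
  · have hfix : (shortPush hl * (longPush hl)⁻¹).1 (Fin.castAdd 2 ⟨i, hi⟩) =
        Fin.castAdd 2 ⟨i, hi⟩ := Fin.ext (by
      rw [val_shortPush_mul_longPush_inv]
      simp only [Fin.val_castAdd]
      lia)
    have hgi : g.1 (Fin.castAdd 2 ⟨i, hi⟩) = (s ++ [x])[i]'(by simp [hs, hi]) := by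
      rw [← List.getElem_of_eq h (by rwa [length_initialEntries])]
      exact (List.getElem_ofFn (f := fun i : Fin (l + 1) => g.1 (i.castAdd 2)) _).symm
    rw [hfix, hgi, List.getElem_append_left (by lia), List.getElem_append_left (by lia)]
  · have hmove : (shortPush hl * (longPush hl)⁻¹).1 (Fin.castAdd 2 ⟨i, hi⟩) =
        Fin.natAdd (i + 1) (0 : Fin 2) := Fin.ext (by
      rw [val_shortPush_mul_longPush_inv]
      simp)
    rw [hmove, List.getElem_append_right hs.le]
    simp

theorem initialCycle_of_cyclesDifferInOnePlace (hl : Even l)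
    {g h k : alternatingGroup (Fin (l + 3))}
    (hE : CyclesDifferInOnePlace (initialCycle g) (initialCycle h) (initialCycle k)) :
    ∃ g', initialCycle g' = initialCycle g ∧
      (initialCycle (g' * (shortPush hl * (longPush hl)⁻¹)) = initialCycle h ∧
        initialCycle (g' * (shortPush hl * (longPush hl)⁻¹) * (shortPush hl * (longPush hl)⁻¹)) =
          initialCycle k ∨
        initialCycle (g' * (shortPush hl * (longPush hl)⁻¹)) = initialCycle k ∧
        initialCycle (g' * (shortPush hl * (longPush hl)⁻¹) * (shortPush hl * (longPush hl)⁻¹)) =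
          initialCycle h) := by
  obtain ⟨_, _, _, ⟨u, v, x, y, z, hxy, hxz, hyz, rfl, rfl, rfl⟩, hg, hh, hk⟩ := hE
  have hrot (t : Fin (l + 3)) : ((u ++ t :: v : List _) : Cycle (Fin (l + 3))) =
      (v ++ u ++ [t] : List _) := Cycle.coe_eq_coe.2 (by
    simpa using List.isRotated_append (l := u ++ [t]) (l' := v))
  have hnodup {t : Fin (l + 3)} {f : alternatingGroup (Fin (l + 3))}
      (hf : initialCycle f = (v ++ u ++ [t] : List _)) :
      (v ++ u ++ [t]).Nodup ∧ (v ++ u ++ [t]).length = l + 1 :=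
    range_initialCycle.subset ⟨f, hf⟩
  rw [hrot] at hg hh hk
  obtain ⟨g', hg'⟩ := exists_initialEntries_eq (hnodup hg).1 (hnodup hg).2
  have hc := initialEntries_mul_eq_concat hl hg'
  have hcc := initialEntries_mul_eq_concat hl hc
  have hmove : (shortPush hl * (longPush hl)⁻¹).1 (Fin.natAdd (l + 1) (0 : Fin 2)) =
      Fin.natAdd (l + 1) (1 : Fin 2) :=
    Fin.ext (by rw [val_shortPush_mul_longPush_inv]; simp)
  rw [Subgroup.coe_mul _ g', Perm.mul_apply, hmove] at hcc
  refine ⟨g', by rw [initialCycle, hg', hg], ?_⟩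
  have hnew {t : Fin (l + 3)} {f : alternatingGroup (Fin (l + 3))}
      (hf : initialCycle f = (v ++ u ++ [t] : List _)) (hxt : x ≠ t) : t ∉ initialEntries g' := by
    rw [hg', List.mem_append, List.mem_singleton, not_or]
    exact ⟨fun ht => (List.nodup_append'.1 (hnodup hf).1).2.2 ht (List.mem_singleton_self t),
      hxt.symm⟩
  rw [hh, hk, initialCycle, hc, initialCycle, hcc]
  rcases eq_or_eq_of_notMem_initialEntries (hnew hh hxy) with rfl | rfl <;>
    rcases eq_or_eq_of_notMem_initialEntries (hnew hk hxz) with rfl | rfl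
  · exact absurd rfl hyz
  · exact .inl ⟨rfl, rfl⟩
  · exact .inr ⟨rfl, rfl⟩
  · exact absurd rfl hyz

theorem hasHamiltonianPath_evenPushes (hl : Even l) (hl2 : 2 ≤ l) :
    HasHamiltonianPath (fun x y => y = x * shortPush hl ∨ y = x * longPush hl)
      {x | longPush hl * x ∉ Subgroup.zpowers (shortPush hl)} 1 (shortPush hl)⁻¹ := by
  obtain ⟨C₀, hC₀, hlen, hT⟩ :=
    exists_isHyperTree_cyclic (α := Fin (l + 3)) hl2 hl (Fintype.card_fin _)
  obtain ⟨g, rfl⟩ : C₀ ∈ Set.range initialCycle := range_initialCycle ▸ ⟨hC₀, hlen⟩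
  rw [← range_initialCycle] at hT
  have htrav : Traversable (shortPush hl) (longPush hl) _ :=
    .of_isHyperTree (isOfFinOrder_of_finite _) (shortPush_mul_longPush_inv_pow_three hl)
      (initialCycle_eq_iff hl) (fun _ _ _ => initialCycle_of_cyclesDifferInOnePlace hl) hT
      Set.sdiff_subset
  refine Traversable.path_of_compl_leftCoset (g := g) ?_
    (longPush_notMem_zpowers_shortPush hl)
  convert htrav using 1
  ext x
  simp [← initialCycle_eq_iff, eq_comm]

theorem two_mul_ncard_longPush_mul_notMem_zpowers (hl : Even l) (hl0 : l ≠ 0) :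
    2 * ({x | longPush hl * x ∉ Subgroup.zpowers (shortPush hl)}.ncard + (l + 1)) =
      (l + 3).factorial := by
  have horder : orderOf (shortPush hl) = l + 1 :=
    orderOf_evenPush hl (Fin.ne_of_val_ne (by simpa using hl0))
  rw [← horder, ncard_setOf_mul_notMem_zpowers_add_orderOf, two_mul_nat_card_alternatingGroup,
    Nat.card_perm, Nat.card_fin]

end EvenPushes

section ExtendLast

open Equiv

variable {n : ℕ}

/-- The even permutations of `n` indices as permutations of `n + 1` indices fixing the last. -/
noncomputable def extendLast : alternatingGroup (Fin n) →* Perm (Fin (n + 1)) :=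
  (Perm.viaEmbeddingHom Fin.castSuccEmb).comp (alternatingGroup (Fin n)).subtype

theorem extendLast_injective : Function.Injective (extendLast (n := n)) :=
  (Perm.viaEmbeddingHom_injective _).comp Subtype.val_injective

theorem extendLast_castSucc (g : alternatingGroup (Fin n)) (i : Fin n) :
    extendLast g i.castSucc = (g.1 i).castSucc :=
  Perm.viaEmbedding_apply g.1 Fin.castSuccEmb i

theorem extendLast_last (g : alternatingGroup (Fin n)) :
    extendLast g (Fin.last n) = Fin.last n :=
  Perm.viaEmbedding_apply_of_notMem g.1 _ _ fun ⟨i, hi⟩ => i.castSucc_ne_last hi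

theorem sign_extendLast (g : alternatingGroup (Fin n)) : Perm.sign (extendLast g) = 1 := by
  rw [extendLast, MonoidHom.comp_apply, Perm.viaEmbeddingHom_apply, Perm.viaEmbedding]
  convert! (Perm.sign_extendDomain g.1 (ofInjective _ Fin.castSuccEmb.injective)).trans g.2

theorem extendLast_evenPush {j : Fin n} (hj : Even (j : ℕ)) :
    extendLast (evenPush j hj) = (Fin.cycleRange j.castSucc)⁻¹ := by
  refine Equiv.ext fun i => Fin.ext ?_
  induction i using Fin.lastCases with
  | last =>
    have := j.2
    simp only [extendLast_last, val_cycleRange_inv, Fin.val_last, Fin.val_castSucc]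
    split_ifs <;> lia
  | cast i =>
    simp only [extendLast_castSucc, evenPush, val_cycleRange_inv, Fin.val_castSucc]

end ExtendLast

section Pushes

open Equiv

variable {n : ℕ} {x y : Perm (Fin n)}

/-- The transitions of a push-to-the-top Gray code. -/
def IsPush (x y : Perm (Fin n)) : Prop :=
  ∃ j : Fin n, 0 < (j : ℕ) ∧ y = pushToTop j x

theorem IsPush.mul_left (z : Perm (Fin n)) (h : IsPush x y) : IsPush (z * x) (z * y) :=
  let ⟨j, hj, hy⟩ := h
  ⟨j, hj, by rw [hy, pushToTop, pushToTop, mul_assoc]⟩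

theorem isPush_mul_extendLast_evenPush {j : Fin n} (hj : Even (j : ℕ)) (hj0 : 0 < (j : ℕ))
    (x : Perm (Fin (n + 1))) : IsPush x (x * extendLast (evenPush j hj)) :=
  ⟨j.castSucc, hj0, by rw [extendLast_evenPush, pushToTop]⟩

theorem IsAdjTransposition.sign_eq_neg_one {s : Perm (Fin n)} (hs : IsAdjTransposition s) :
    Perm.sign s = -1 := by
  obtain ⟨i, j, hij, rfl⟩ := hs
  exact Perm.sign_swap (Fin.ne_of_val_ne (by lia))

theorem IsAdjTransposition.mul_self {s : Perm (Fin n)} (hs : IsAdjTransposition s) :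
    s * s = 1 := by
  obtain ⟨i, j, -, rfl⟩ := hs
  exact swap_mul_self i j

theorem two_le_kendallTau (hxy : x ≠ y) (h : ∀ s, IsAdjTransposition s → x ≠ y * s) :
    2 ≤ kendallTau x y := by
  obtain ⟨L, hlen, hL, hx⟩ := kendallTau_spec x y
  rw [← hlen]
  match L, hL, hx with
  | [], _, hx => exact absurd (by simpa using hx) hxy
  | [s], hL, hx => exact absurd (by simpa using hx) (h s (hL s (List.mem_singleton_self s)))
  | _ :: _ :: _, _, _ => exact Nat.le_add_left 2 _

theorem HasHamiltonianCycle.exists_isKendallSnake {S : Set (Perm (Fin n))}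
    (hS : HasHamiltonianCycle IsPush S) (hd : ∀ x ∈ S, ∀ y ∈ S, x ≠ y → 2 ≤ kendallTau x y) :
    ∃ c, IsKendallSnake n S.ncard c := by
  obtain ⟨s, hs, hsS, hsR⟩ := hS
  induction s using Quotient.inductionOn with
  | _ L =>
  change (L : Cycle (Perm (Fin n))).Nodup at hs
  change ∀ z, z ∈ (L : Cycle (Perm (Fin n))) ↔ z ∈ S at hsS
  change (L : Cycle (Perm (Fin n))).Chain IsPush at hsR
  simp only [Cycle.nodup_coe_iff, Cycle.mem_coe_iff] at hs hsS
  have hlen : S.ncard = L.length := by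
    rw [← List.toFinset_card_of_nodup hs, ← Set.ncard_coe_finset]
    congr 1
    ext z
    simp [hsS]
  rw [hlen]
  refine ⟨L.get, ⟨List.nodup_iff_injective_get.1 hs, fun r => ?_⟩, ?_⟩
  · cases L with
    | nil => exact r.elim0
    | cons y K =>
      rw [Cycle.chain_coe_cons] at hsR
      rw [← List.cons_append] at hsR
      change IsPush _ _
      convert List.isChain_iff_getElem.1 hsR r (by simpa using r.is_le) using 1
      · exact (List.getElem_append_left r.2).symm
      · change Fin (K.length + 1) at r
        simp only [List.length_cons, List.get_eq_getElem, List.cons_append,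
          List.getElem_cons_succ, coe_finRotate]
        split_ifs with hr
        · simp [hr]
        · exact (List.getElem_append_left (Fin.val_lt_last hr)).symm
  · rintro _ ⟨i, rfl⟩ _ ⟨j, rfl⟩
    exact hd _ ((hsS _).1 (List.get_mem _ _)) _ ((hsS _).1 (List.get_mem _ _))

end Pushes

section Code

open Equiv
open scoped Pointwise

variable {l : ℕ}

/-- The odd permutation of `l + 4` indices that is multiplied by when the last entry is pushed to
the top. -/
def fullPush (l : ℕ) : Perm (Fin (l + 4)) := (Fin.cycleRange (Fin.last (l + 3)))⁻¹

theorem isPush_mul_fullPush (x : Perm (Fin (l + 4))) : IsPush x (x * fullPush l) :=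
  ⟨Fin.last (l + 3), Nat.succ_pos _, rfl⟩

/-- The odd codeword of the block that starts at the identity. -/
noncomputable def oddCodeword (hl : Even l) : Perm (Fin (l + 4)) :=
  (extendLast (shortPush hl))⁻¹ * fullPush l

/-- The block of codewords that starts at the identity: the even ones fix the last index, and they
are followed by a single odd one. -/
def block (hl : Even l) : Set (Perm (Fin (l + 4))) :=
  extendLast '' {x | longPush hl * x ∉ Subgroup.zpowers (shortPush hl)} ∪ {oddCodeword hl}

/-- The first codeword of the block that follows the one starting at the identity. -/
noncomputable def blockShift (hl : Even l) : Perm (Fin (l + 4)) := oddCodeword hl * fullPush l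

/-- The codewords of the snake of permutations of `l + 4` indices. -/
def codewords (hl : Even l) : Set (Perm (Fin (l + 4))) :=
  ⋃ i ∈ Set.Iic (l + 1), blockShift hl ^ i • block hl

theorem val_oddCodeword (hl : Even l) (i : Fin (l + 4)) : (oddCodeword hl i : ℕ) =
    if (i : ℕ) = 0 then l + 3 else if (i : ℕ) = l + 1 then 0 else
      if (i : ℕ) ≤ l then (i : ℕ) else (i : ℕ) - 1 := by
  simp only [oddCodeword, fullPush, shortPush, extendLast_evenPush, inv_inv, Perm.mul_apply,
    val_cycleRange, val_cycleRange_inv, Fin.val_castSucc, Fin.val_castAdd, Fin.val_last]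
  split_ifs <;> lia

theorem val_blockShift (hl : Even l) (i : Fin (l + 4)) : (blockShift hl i : ℕ) =
    if (i : ℕ) = 0 then l + 2 else if (i : ℕ) = 1 then l + 3 else if (i : ℕ) = l + 2 then 0 else
      if (i : ℕ) = l + 3 then l + 1 else (i : ℕ) - 1 := by
  simp only [blockShift, fullPush, Perm.mul_apply, val_oddCodeword, val_cycleRange_inv,
    Fin.val_last]
  split_ifs <;> lia

theorem sign_fullPush (hl : Even l) : Perm.sign (fullPush l) = -1 := by
  rw [fullPush, Perm.sign_inv, Fin.sign_cycleRange, Fin.val_last, Odd.neg_one_pow]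
  exact hl.add_odd (by decide)

theorem sign_oddCodeword (hl : Even l) : Perm.sign (oddCodeword hl) = -1 := by
  rw [oddCodeword, Perm.sign_mul, Perm.sign_inv, sign_extendLast, sign_fullPush hl, one_mul]

theorem sign_blockShift (hl : Even l) : Perm.sign (blockShift hl) = 1 := by
  rw [blockShift, Perm.sign_mul, sign_oddCodeword, sign_fullPush hl, neg_mul_neg, one_mul]

theorem val_blockShift_pow_last (hl : Even l) {i : ℕ} (hi : i ≤ l + 1) :
    ((blockShift hl ^ i) (Fin.last (l + 3)) : ℕ) = if i = 0 then l + 3 else l + 2 - i := by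
  induction i with
  | zero => simp
  | succ i ih =>
    rw [pow_succ', Perm.mul_apply, val_blockShift, ih (by lia)]
    split_ifs <;> lia

theorem val_blockShift_pow_penultimate (hl : Even l) (i : ℕ) :
    ((blockShift hl ^ i) (Fin.last (l + 2)).castSucc : ℕ) = if Even i then l + 2 else 0 := by
  induction i with
  | zero => simp
  | succ i ih =>
    rw [pow_succ', Perm.mul_apply, val_blockShift, ih]
    by_cases h : Even i <;> simp [h, Nat.even_add_one]

theorem exists_blockShift_pow_apply_eq (hl : Even l) (i : Fin (l + 4)) :
    ∃ k, (blockShift hl ^ k) (Fin.last (l + 3)) = i ∨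
      (blockShift hl ^ k) (Fin.last (l + 2)).castSucc = i := by
  have hi := i.2
  rcases eq_or_ne (i : ℕ) (l + 3) with h | h
  · exact ⟨0, .inl (Fin.ext (by simp [h]))⟩
  rcases eq_or_ne (i : ℕ) (l + 2) with h | h
  · exact ⟨0, .inr (Fin.ext (by simp [h]))⟩
  rcases eq_or_ne (i : ℕ) 0 with h | h
  · exact ⟨1, .inr (Fin.ext (by rw [val_blockShift_pow_penultimate, h]; simp))⟩
  · exact ⟨l + 2 - i, .inl (Fin.ext (by rw [val_blockShift_pow_last hl (by lia)]; lia))⟩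

theorem blockShift_pow_eq_one (hl : Even l) : blockShift hl ^ (l + 2) = 1 := by
  have hlast : (blockShift hl ^ (l + 2)) (Fin.last (l + 3)) = Fin.last (l + 3) := Fin.ext (by
    rw [pow_succ', Perm.mul_apply, val_blockShift, val_blockShift_pow_last hl le_rfl, Fin.val_last]
    split_ifs <;> lia)
  have hpen : (blockShift hl ^ (l + 2)) (Fin.last (l + 2)).castSucc =
      (Fin.last (l + 2)).castSucc := Fin.ext (by
    rw [val_blockShift_pow_penultimate, if_pos (hl.add even_two), Fin.val_castSucc, Fin.val_last])
  refine Equiv.ext fun i => ?_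
  obtain ⟨k, rfl | rfl⟩ := exists_blockShift_pow_apply_eq hl i
  · rw [← Perm.mul_apply, pow_mul_comm, Perm.mul_apply, hlast, Perm.one_apply]
  · rw [← Perm.mul_apply, pow_mul_comm, Perm.mul_apply, hpen, Perm.one_apply]

theorem blockShift_pow_apply_last_injOn (hl : Even l) :
    (Set.Iic (l + 1)).InjOn fun i => (blockShift hl ^ i) (Fin.last (l + 3)) := by
  intro i hi j hj hij
  have := congrArg Fin.val hij
  simp only [val_blockShift_pow_last hl hi, val_blockShift_pow_last hl hj] at this
  rw [Set.mem_Iic] at hi hj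
  split_ifs at this <;> lia

theorem blockShift_pow_eq_pow (hl : Even l) {i j : ℕ}
    (h : (blockShift hl ^ i) (Fin.last (l + 3)) = (blockShift hl ^ j) (Fin.last (l + 3))) :
    blockShift hl ^ i = blockShift hl ^ j := by
  rw [pow_eq_pow_mod i (blockShift_pow_eq_one hl), pow_eq_pow_mod j (blockShift_pow_eq_one hl)]
    at h ⊢
  exact congrArg _ (blockShift_pow_apply_last_injOn hl (Nat.lt_succ_iff.1 (Nat.mod_lt _ (by lia)))
    (Nat.lt_succ_iff.1 (Nat.mod_lt _ (by lia))) h)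

theorem mem_blockShift_pow_smul_block (hl : Even l) {i : ℕ} {x : Perm (Fin (l + 4))} :
    x ∈ blockShift hl ^ i • block hl ↔
      (∃ g, longPush hl * g ∉ Subgroup.zpowers (shortPush hl) ∧
        x = blockShift hl ^ i * extendLast g) ∨ x = blockShift hl ^ i * oddCodeword hl := by
  simp [block, Set.mem_smul_set_iff_inv_smul_mem, eq_inv_mul_iff_mul_eq,
    @eq_comm _ x, inv_mul_eq_iff_eq_mul, or_comm]

theorem sign_blockShift_pow_mul_extendLast (hl : Even l) (i : ℕ)
    (g : alternatingGroup (Fin (l + 3))) : Perm.sign (blockShift hl ^ i * extendLast g) = 1 := by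
  rw [Perm.sign_mul, map_pow, sign_blockShift, one_pow, one_mul, sign_extendLast]

theorem sign_blockShift_pow_mul_oddCodeword (hl : Even l) (i : ℕ) :
    Perm.sign (blockShift hl ^ i * oddCodeword hl) = -1 := by
  rw [Perm.sign_mul, map_pow, sign_blockShift, one_pow, one_mul, sign_oddCodeword]

theorem pairwiseDisjoint_blockShift_pow_smul_block (hl : Even l) :
    (Set.Iic (l + 1)).PairwiseDisjoint fun i => blockShift hl ^ i • block hl := by
  intro i hi j hj hij
  refine Set.disjoint_left.2 fun x hxi hxj => hij (blockShift_pow_apply_last_injOn hl hi hj ?_)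
  have hsign (k k' : ℕ) (g : alternatingGroup (Fin (l + 3))) :
      blockShift hl ^ k * extendLast g ≠ blockShift hl ^ k' * oddCodeword hl := fun h => by
    have := congrArg Perm.sign h
    rw [sign_blockShift_pow_mul_extendLast, sign_blockShift_pow_mul_oddCodeword] at this
    exact absurd this (by decide)
  rcases (mem_blockShift_pow_smul_block hl).1 hxi with ⟨g, -, rfl⟩ | rfl <;>
    rcases (mem_blockShift_pow_smul_block hl).1 hxj with ⟨g', -, h⟩ | h
  · simpa only [Perm.mul_apply, extendLast_last] using DFunLike.congr_fun h (Fin.last (l + 3))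
  · exact absurd h (hsign _ _ _)
  · exact absurd h.symm (hsign _ _ _)
  · exact DFunLike.congr_fun (mul_right_cancel h) _

theorem oddCodeword_notMem_image (hl : Even l) (S : Set (alternatingGroup (Fin (l + 3)))) :
    oddCodeword hl ∉ extendLast '' S := by
  rintro ⟨g, -, h⟩
  have := congrArg Perm.sign h
  rw [sign_extendLast, sign_oddCodeword] at this
  exact absurd this (by decide)

theorem hasHamiltonianPath_block (hl : Even l) (hl2 : 2 ≤ l) :
    HasHamiltonianPath IsPush (block hl) 1 (oddCodeword hl) := by
  have heven := (hasHamiltonianPath_evenPushes hl hl2).image extendLast_injective (R' := IsPush)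
    fun x y h => by
      rcases h with rfl | rfl <;> rw [map_mul]
      · exact isPush_mul_extendLast_evenPush _ (show 0 < l by lia) _
      · exact isPush_mul_extendLast_evenPush _ (Nat.succ_pos (l + 1)) _
  rw [map_one, map_inv] at heven
  exact heven.append (.singleton _)
    (Set.disjoint_singleton_right.2 (oddCodeword_notMem_image hl _)) (isPush_mul_fullPush _)

theorem hasHamiltonianCycle_codewords (hl : Even l) (hl2 : 2 ≤ l) :
    HasHamiltonianCycle IsPush (codewords hl) := by
  refine (hasHamiltonianPath_block hl hl2).hasHamiltonianCycle_biUnion_pow_smul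
    (fun _ _ h => h.mul_left _) ?_ (blockShift_pow_eq_one hl)
    (pairwiseDisjoint_blockShift_pow_smul_block hl)
  rw [mul_one]
  exact isPush_mul_fullPush _

theorem fullPush_mul_extendLast_longPush_inv (hl : Even l) :
    fullPush l * extendLast (longPush hl)⁻¹ =
      swap (Fin.last (l + 2)).castSucc (Fin.last (l + 3)) := by
  rw [map_inv, longPush, extendLast_evenPush, inv_inv, fullPush]
  refine Equiv.ext fun i => Fin.ext ?_
  simp only [Perm.mul_apply, val_cycleRange_inv, val_cycleRange, swap_apply_def,
    apply_ite Fin.val, Fin.ext_iff, Fin.val_castSucc, Fin.val_last]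
  split_ifs <;> lia

theorem blockShift_pow_mul_extendLast_ne (hl : Even l) {i : ℕ} (hi : i ≤ l + 1) (j : ℕ)
    {g : alternatingGroup (Fin (l + 3))}
    (hg : longPush hl * g ∉ Subgroup.zpowers (shortPush hl)) {s : Perm (Fin (l + 4))}
    (hs : IsAdjTransposition s) :
    blockShift hl ^ i * extendLast g ≠ blockShift hl ^ j * oddCodeword hl * s := by
  intro h
  have hlast := DFunLike.congr_fun h (Fin.last (l + 3))
  rw [Perm.mul_apply, extendLast_last] at hlast
  obtain ⟨p, q, hpq, rfl⟩ := hs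
  rcases eq_or_ne q (Fin.last (l + 3)) with rfl | hq
  · obtain rfl : p = (Fin.last (l + 2)).castSucc := Fin.ext (by simpa using hpq)
    rw [← fullPush_mul_extendLast_longPush_inv hl, mul_assoc, ← mul_assoc (oddCodeword hl),
      ← blockShift, ← mul_assoc, ← pow_succ] at h hlast
    rw [Perm.mul_apply, extendLast_last] at hlast
    rw [blockShift_pow_eq_pow hl hlast] at h
    refine hg ?_
    rw [extendLast_injective (mul_left_cancel h), mul_inv_cancel]
    exact one_mem _
  · have hp : p ≠ Fin.last (l + 3) := Fin.ne_of_val_ne (by simp only [Fin.val_last]; lia)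
    have hodd : oddCodeword hl (Fin.last (l + 3)) = (Fin.last (l + 2)).castSucc :=
      Fin.ext (by simp [val_oddCodeword])
    rw [Perm.mul_apply, swap_apply_of_ne_of_ne hp.symm hq.symm, Perm.mul_apply, hodd] at hlast
    have hval := congrArg Fin.val hlast
    rw [val_blockShift_pow_last hl hi, val_blockShift_pow_penultimate] at hval
    split_ifs at hval <;> lia

theorem two_le_kendallTau_of_mem_codewords (hl : Even l) {x y : Perm (Fin (l + 4))}
    (hx : x ∈ codewords hl) (hy : y ∈ codewords hl) (hxy : x ≠ y) : 2 ≤ kendallTau x y := by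
  refine two_le_kendallTau hxy fun s hs h => ?_
  have hsign := congrArg Perm.sign h
  rw [Perm.sign_mul, hs.sign_eq_neg_one] at hsign
  simp only [codewords, Set.mem_iUnion, Set.mem_Iic, mem_blockShift_pow_smul_block] at hx hy
  obtain ⟨i, hi, ⟨g, hg, rfl⟩ | rfl⟩ := hx <;> obtain ⟨j, hj, ⟨g', hg', rfl⟩ | rfl⟩ := hy
  · simp only [sign_blockShift_pow_mul_extendLast] at hsign
    exact absurd hsign (by decide)
  · exact blockShift_pow_mul_extendLast_ne hl hi j hg hs h
  · refine blockShift_pow_mul_extendLast_ne hl hj i hg' hs ?_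
    rw [h, mul_assoc, hs.mul_self, mul_one]
  · simp only [sign_blockShift_pow_mul_oddCodeword] at hsign
    exact absurd hsign (by decide)

theorem ncard_block (hl : Even l) (hl0 : l ≠ 0) :
    (block hl).ncard = (l + 3).factorial / 2 - l := by
  have h := two_mul_ncard_longPush_mul_notMem_zpowers hl hl0
  rw [block, Set.union_singleton, Set.ncard_insert_of_notMem (oddCodeword_notMem_image hl _),
    Set.ncard_image_of_injective _ extendLast_injective]
  lia

theorem ncard_codewords (hl : Even l) (hl0 : l ≠ 0) :
    (codewords hl).ncard = (l + 2) * ((l + 3).factorial / 2 - l) := by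
  rw [codewords, (Set.finite_Iic _).ncard_biUnion (fun _ _ => Set.toFinite _)
    (pairwiseDisjoint_blockShift_pow_smul_block hl)]
  simp only [Set.ncard_smul_set, ncard_block hl hl0]
  rw [finsum_mem_eq_finite_toFinset_sum _ (Set.finite_Iic _), Finset.sum_const, smul_eq_mul]
  simp

theorem exists_isKendallSnake (hl : Even l) (hl2 : 2 ≤ l) :
    ∃ c, IsKendallSnake (l + 4) ((l + 2) * ((l + 3).factorial / 2 - l)) c := by
  rw [← ncard_codewords hl (by lia)]
  exact (hasHamiltonianCycle_codewords hl hl2).exists_isKendallSnake fun _ hx _ hy =>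
    two_le_kendallTau_of_mem_codewords hl hx hy

end Code

section UpperBound

variable {n N : ℕ}

theorem kendallTau_mul_le_one {s : Equiv.Perm (Fin n)} (hs : IsAdjTransposition s)
    (x : Equiv.Perm (Fin n)) : kendallTau (x * s) x ≤ 1 :=
  Nat.sInf_le ⟨[s], rfl, by simpa using hs, by simp⟩

theorem IsAdjTransposition.ne_one {s : Equiv.Perm (Fin n)} (hs : IsAdjTransposition s) :
    s ≠ 1 := by
  rintro rfl
  exact absurd (Equiv.Perm.sign_one.symm.trans (hs.sign_eq_neg_one)) (by decide)

theorem IsKendallSnake.two_mul_le_factorial {c : Fin N → Equiv.Perm (Fin n)}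
    (h : IsKendallSnake n N c) : 2 * N ≤ n.factorial := by
  rcases Nat.eq_zero_or_pos N with rfl | hN
  · simp
  obtain ⟨j, hj, -⟩ := h.1.2 ⟨0, hN⟩
  obtain ⟨s, hs⟩ : ∃ s : Equiv.Perm (Fin n), IsAdjTransposition s :=
    ⟨_, ⟨0, by lia⟩, ⟨1, by lia⟩, rfl, rfl⟩
  have hinj : Function.Injective (Sum.elim c (c · * s)) := by
    refine h.1.1.sumElim ((mul_left_injective s).comp h.1.1) fun a b hab => ?_
    have hne : c a ≠ c b := hab ▸ hs.ne_one ∘ mul_eq_left.1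
    have hdist := h.2 _ ⟨a, rfl⟩ _ ⟨b, rfl⟩ hne
    exact absurd (hdist.trans (hab ▸ kendallTau_mul_le_one hs (c b))) (by decide)
  have hcard := Fintype.card_le_of_injective _ hinj
  rwa [Fintype.card_sum, Fintype.card_fin, Fintype.card_perm, Fintype.card_fin, ← two_mul] at hcard

theorem IsKendallSnake.div_card_le_half {c : Fin N → Equiv.Perm (Fin n)}
    (h : IsKendallSnake n N c) : (N : ℝ) / (Nat.card (Equiv.Perm (Fin n)) : ℝ) ≤ 1 / 2 := by
  have hN : (2 * N : ℝ) ≤ n.factorial := mod_cast h.two_mul_le_factorial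
  rw [Nat.card_perm, Nat.card_fin, div_le_iff₀ (by positivity)]
  linarith

end UpperBound

section SnakeSize

/-- The size `M̌_{2m+2}` of the snake of permutations of `2m + 2` indices. It is written so that
the division by `2` is exact and, for `m ≥ 1`, no subtraction is truncated. -/
def snakeSize (m : ℕ) : ℕ := 2 * m * ((2 * m + 1).factorial / 2 - (2 * m - 2))

theorem cast_snakeSize (m : ℕ) : (snakeSize m : ℝ) =
    (2 * m : ℝ) / (2 * m + 2) * ((Nat.factorial (2 * m + 2) : ℝ) / 2) -
      (2 * m - 2) * (2 * m) := by
  rcases m.eq_zero_or_pos with rfl | hm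
  · simp [snakeSize]
  have hdvd : 2 ∣ (2 * m + 1).factorial := Nat.dvd_factorial two_pos (by lia)
  have hle : 2 * m - 2 ≤ (2 * m + 1).factorial / 2 := by
    have : 2 ≤ (2 * m).factorial := (show 2 ≤ 2 * m by lia).trans (Nat.self_le_factorial _)
    rw [Nat.le_div_iff_mul_le two_pos, Nat.factorial_succ]
    nlinarith [Nat.sub_le (2 * m) 2]
  rw [snakeSize, Nat.cast_mul, Nat.cast_sub hle, Nat.cast_div hdvd (by norm_num),
    Nat.cast_sub (by lia), Nat.factorial_succ (2 * m + 1)]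
  push_cast
  have : (2 * m + 2 : ℝ) ≠ 0 := by positivity
  field_simp
  ring

theorem tendsto_mul_div_factorial :
    Tendsto (fun m : ℕ => (2 * m - 2 : ℝ) * (2 * m) / (Nat.factorial (2 * m + 2) : ℝ)) atTop
      (𝓝 0) := by
  refine squeeze_zero' ?_ ?_ (tendsto_one_div_atTop_nhds_zero_nat (𝕜 := ℝ))
  · filter_upwards [eventually_ge_atTop 1] with m hm
    have : (1 : ℝ) ≤ m := mod_cast hm
    have : (0 : ℝ) ≤ 2 * m - 2 := by linarith
    positivity
  · filter_upwards [eventually_ge_atTop 1] with m hm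
    have hm : (1 : ℝ) ≤ m := mod_cast hm
    have hfact : (2 * m : ℝ) ≤ (2 * m).factorial := mod_cast Nat.self_le_factorial (2 * m)
    rw [div_le_div_iff₀ (by positivity) (by positivity), one_mul, Nat.factorial_succ,
      Nat.factorial_succ]
    push_cast
    calc (2 * m - 2 : ℝ) * (2 * m) * m ≤ (2 * m + 2) * (2 * m + 1) * (2 * m) := by
          gcongr <;> linarith
      _ ≤ (2 * m + 2) * (2 * m + 1) * (2 * m).factorial := by gcongr
      _ = (2 * m + 1 + 1) * ((2 * m + 1) * (2 * m).factorial) := by ring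

theorem tendsto_snakeSize_div_card :
    Tendsto (fun m : ℕ => (snakeSize m : ℝ) / (Nat.card (Equiv.Perm (Fin (2 * m + 2))) : ℝ))
      atTop (𝓝 (1 / 2)) := by
  have hlim : Tendsto (fun m : ℕ => 1 / 2 * ((m : ℝ) / (m + 1)) -
      (2 * m - 2 : ℝ) * (2 * m) / (Nat.factorial (2 * m + 2) : ℝ)) atTop (𝓝 (1 / 2)) := by
    simpa only [mul_one, sub_zero] using
      ((tendsto_natCast_div_add_atTop (1 : ℝ)).const_mul (1 / 2)).sub tendsto_mul_div_factorial
  refine hlim.congr fun m => ?_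
  rw [cast_snakeSize, Nat.card_perm, Nat.card_fin, sub_div]
  field_simp

theorem exists_isKendallSnake_snakeSize {m : ℕ} (hm : 2 ≤ m) :
    ∃ c, IsKendallSnake (2 * m + 2) (snakeSize m) c := by
  obtain ⟨l, rfl⟩ : ∃ l, m = l + 1 := Nat.exists_eq_add_one.2 (by lia)
  exact exists_isKendallSnake (l := 2 * l) (even_two_mul l) (by lia)

end SnakeSize

end RankModulation

theorem mainTheorem5 :
    ∃ M : ℕ → ℕ,
      (∀ m : ℕ, 2 ≤ m →
        (M m : ℝ) =
          (2 * m : ℝ) / (2 * m + 2) * ((Nat.factorial (2 * m + 2) : ℝ) / 2)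
            - (2 * m - 2) * (2 * m) ∧
        ∃ c : Fin (M m) → Equiv.Perm (Fin (2 * m + 2)),
          RankModulation.IsKendallSnake (2 * m + 2) (M m) c) ∧
      Tendsto (fun m : ℕ => (M m : ℝ) / (Nat.card (Equiv.Perm (Fin (2 * m + 2))) : ℝ))
        atTop (𝓝 (1 / 2)) ∧
      ∀ (n N : ℕ) (c : Fin N → Equiv.Perm (Fin n)),
        RankModulation.IsKendallSnake n N c →
          (N : ℝ) / (Nat.card (Equiv.Perm (Fin n)) : ℝ) ≤ 1 / 2 :=
  ⟨RankModulation.snakeSize,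
    fun m hm => ⟨RankModulation.cast_snakeSize m,
      RankModulation.exists_isKendallSnake_snakeSize hm⟩,
    RankModulation.tendsto_snakeSize_div_card,
    fun _ _ _ => RankModulation.IsKendallSnake.div_card_le_half⟩
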